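/- Let $(L,g_L)$ be a smooth finite-dimensional Riemannian manifold and $(K,\varphi,g_K)$ a Kähler manifold, that is, a smooth Riemannian manifold with a smooth almost complex structure $\varphi$ such that $\varphi^2=-\mathrm{Id}$, $g_K(\varphi X,\varphi Y)=g_K(X,Y)$ and $\nabla^K\varphi=0$ for the Levi-Civita connection $\nabla^K$. Let $G:L\to K$ be a conformal pointwise-slant Riemannian map (CPSRM) with slant function $\Theta$: $G$ is smooth; there is a smooth function $\lambda:L\to(0,\infty)$ with $g_K(G_*X,G_*Y)=\lambda(l)^2g_L(X,Y)$ for all $l\in L$ and $X,Y\in(\ker G_{*l})^\perp$; and at each $l\in L$ the angle between $\varphi w$ and the subspace $(\mathrm{range}\,G_*)_l=G_*(T_lL)\subset T_{G(l)}K$ equals $\Theta(l)$ for every nonzero $w\in(\mathrm{range}\,G_*)_l$. Suppose that $\Theta$ is proper, i.e. $0<\Theta(l)<\pi/2$ for all $l\in L$. Regard $\mathrm{range}\,G_*$ and $(\mathrm{range}\,G_*)^\perp$ as subbundles of the pullback bundle $G^{-1}TK\to L$, with pullback connection $\nabla^G$ of $\nabla^K$. For sections $W$ of $\mathrm{range}\,G_*$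 and $P$ of $(\mathrm{range}\,G_*)^\perp$ write $\varphi W=\rho W+\varpi W$ and $\varphi P=\mathcal DP+\mathcal EP$, where $\rho W,\mathcal DP\in\mathrm{range}\,G_*$ and $\varpi W,\mathcal EP\in(\mathrm{range}\,G_*)^\perp$. Let $\nabla^{G\perp}_YV$ be the $(\mathrm{range}\,G_*)^\perp$-component of $\nabla^G_YV$ for a section $V$ of $(\mathrm{range}\,G_*)^\perp$, let $(\nabla G_*)^\perp(Y,X)$ be the $(\mathrm{range}\,G_*)^\perp$-component of $(\nabla G_*)(Y,X)=\nabla^G_YG_*X-G_*(\nabla^L_YX)$, and let ${}^*G_*$ be the adjoint of $G_*$ with respect to $g_L$ and $g_K$. Then $\mathrm{range}\,G_*$ defines a totally geodesic foliation, i.e. $\nabla^G_Y G_*Z$ is a section of $\mathrm{range}\,G_*$ for all $Y,Z\in\Gamma((\ker G_*)^\perp)$, if and only if $$g_K\big((\nabla G_*)^\perp(Y,{}^*G_*\mathcal DP),\varpi G_*Z\big)=g_K\big(\nabla^{G\perp}_Y\varpi G_*Z,\mathcal EP\big)-g_K\big(\nabla^{G\perp}_Y\varpi\rho G_*Z,P\big)$$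 for all smooth sections $Y,Z\in\Gamma((\ker G_*)^\perp)$ and $P\in\Gamma((\mathrm{range}\,G_*)^\perp)$. -/

import Mathlib

open Bundle Manifold
open scoped ContDiff Manifold

noncomputable section

namespace ConformalSlant

section LeviCivita

variable {F : Type*} [NormedAddCommGroup F] [NormedSpace ℝ F]
  {K : Type*} [TopologicalSpace K] [ChartedSpace F K]

/-- The tangent spaces of a finite-dimensional manifold are finite-dimensional. -/
instance instFiniteDimensionalTangentSpace [FiniteDimensional ℝ F] (x : K) :
    FiniteDimensional ℝ (TangentSpace 𝓘(ℝ, F) x) :=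
  inferInstanceAs (FiniteDimensional ℝ F)

variable [IsManifold 𝓘(ℝ, F) ∞ K]

/-- The vector field near `x` whose components in the preferred chart at `x` are constant, equal to
those of the tangent vector `v` at `x`. It is defined on the domain of that chart, and zero
elsewhere. -/
def coordField (x : K) (v : TangentSpace 𝓘(ℝ, F) x) (y : K) : TangentSpace 𝓘(ℝ, F) y :=
  (trivializationAt F (TangentSpace 𝓘(ℝ, F)) x).symmL ℝ y
    (trivializationAt F (TangentSpace 𝓘(ℝ, F)) x ⟨x, v⟩).2

variable [FiniteDimensional ℝ F] [RiemannianBundle (fun x : K ↦ TangentSpace 𝓘(ℝ, F) x)]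

/-- `metricDeriv x u v w = u (g(V, W))`, where `V` and `W` are the fields with constant components
(in the preferred chart at `x`) which extend `v` and `w`. -/
def metricDeriv (x : K) (u v w : TangentSpace 𝓘(ℝ, F) x) : ℝ :=
  mvfderiv 𝓘(ℝ, F) (fun y : K ↦ inner ℝ (coordField x v y) (coordField x w y)) x u

/-- The Christoffel symbols at `x` in the preferred chart at `x`: `Γ(u, v)` is the vector with
`2 g(Γ(u, v), w) = u g(V, W) + v g(U, W) - w g(U, V)` for all `w`, where `U`, `V`, `W` are the
extensions with constant components. -/
def christoffel (x : K) (u v : TangentSpace 𝓘(ℝ, F) x) : TangentSpace 𝓘(ℝ, F) x :=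
  ∑ i, ((metricDeriv x u v (stdOrthonormalBasis ℝ (TangentSpace 𝓘(ℝ, F) x) i)
      + metricDeriv x v u (stdOrthonormalBasis ℝ (TangentSpace 𝓘(ℝ, F) x) i)
      - metricDeriv x (stdOrthonormalBasis ℝ (TangentSpace 𝓘(ℝ, F) x) i) u v) / 2) •
    stdOrthonormalBasis ℝ (TangentSpace 𝓘(ℝ, F) x) i

/-- The Levi-Civita connection: `leviCivita W x u` is `(∇_u W)(x)`, computed in the preferred chart
at `x` as the derivative of the components of `W` plus the Christoffel term. -/
def leviCivita (W : ∀ x : K, TangentSpace 𝓘(ℝ, F) x) (x : K) (u : TangentSpace 𝓘(ℝ, F) x) :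
    TangentSpace 𝓘(ℝ, F) x :=
  (trivializationAt F (TangentSpace 𝓘(ℝ, F)) x).symmL ℝ x
      (mvfderiv 𝓘(ℝ, F)
        (fun y : K ↦ (trivializationAt F (TangentSpace 𝓘(ℝ, F)) x ⟨y, W y⟩).2) x u)
    + christoffel x u (W x)

end LeviCivita

section Kaehler

variable {F : Type*} [NormedAddCommGroup F] [NormedSpace ℝ F] [FiniteDimensional ℝ F]
  {K : Type*} [TopologicalSpace K] [ChartedSpace F K] [IsManifold 𝓘(ℝ, F) ∞ K]
  [RiemannianBundle (fun x : K ↦ TangentSpace 𝓘(ℝ, F) x)]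

/-- The smooth vector fields on `K`. -/
def IsSmoothField (X : ∀ x : K, TangentSpace 𝓘(ℝ, F) x) : Prop :=
  ContMDiff 𝓘(ℝ, F) (𝓘(ℝ, F).prod 𝓘(ℝ, F)) ∞ (fun x ↦ (⟨x, X x⟩ : TangentBundle 𝓘(ℝ, F) K))

/-- `φ` is a Kähler structure on the Riemannian manifold `K`: a smooth almost complex structure
which preserves the metric and is parallel, `(∇_X φ) Y = ∇_X (φ Y) - φ (∇_X Y) = 0`. -/
structure IsKaehler
    (φ : ∀ x : K, TangentSpace 𝓘(ℝ, F) x →L[ℝ] TangentSpace 𝓘(ℝ, F) x) : Prop where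
  smooth : ContMDiff 𝓘(ℝ, F) (𝓘(ℝ, F).prod 𝓘(ℝ, F →L[ℝ] F)) ∞
    (fun x ↦ TotalSpace.mk' (F →L[ℝ] F)
      (E := fun x : K ↦ TangentSpace 𝓘(ℝ, F) x →L[ℝ] TangentSpace 𝓘(ℝ, F) x) x (φ x))
  sq_eq_neg : ∀ (x : K) (v : TangentSpace 𝓘(ℝ, F) x), φ x (φ x v) = -v
  hermitian : ∀ (x : K) (v w : TangentSpace 𝓘(ℝ, F) x),
    inner ℝ (φ x v) (φ x w) = inner ℝ v w
  parallel : ∀ X Y : ∀ x : K, TangentSpace 𝓘(ℝ, F) x, IsSmoothField X → IsSmoothField Y →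
    ∀ x : K, leviCivita (fun y ↦ φ y (Y y)) x (X x) - φ x (leviCivita Y x (X x)) = 0

end Kaehler

section Maps

variable {E : Type*} [NormedAddCommGroup E] [NormedSpace ℝ E] [FiniteDimensional ℝ E]
  {L : Type*} [TopologicalSpace L] [ChartedSpace E L] [IsManifold 𝓘(ℝ, E) ∞ L]
  [RiemannianBundle (fun x : L ↦ TangentSpace 𝓘(ℝ, E) x)]
  {F : Type*} [NormedAddCommGroup F] [NormedSpace ℝ F] [FiniteDimensional ℝ F]
  {K : Type*} [TopologicalSpace K] [ChartedSpace F K] [IsManifold 𝓘(ℝ, F) ∞ K]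
  [RiemannianBundle (fun x : K ↦ TangentSpace 𝓘(ℝ, F) x)]

/-- The differential `G_*` at `l`. -/
abbrev dmap (G : L → K) (l : L) : TangentSpace 𝓘(ℝ, E) l →L[ℝ] TangentSpace 𝓘(ℝ, F) (G l) :=
  mfderiv 𝓘(ℝ, E) 𝓘(ℝ, F) G l

/-- The vector field `G_* X` along `G`. -/
def pushField (G : L → K) (X : ∀ l : L, TangentSpace 𝓘(ℝ, E) l) (l : L) :
    TangentSpace 𝓘(ℝ, F) (G l) :=
  dmap G l (X l)

/-- The vertical space `ker G_*` at `l`. -/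
abbrev kerG (G : L → K) (l : L) : Submodule ℝ (TangentSpace 𝓘(ℝ, E) l) :=
  LinearMap.ker (dmap (F := F) G l).toLinearMap

/-- The fibre of `range G_*` at `l`. -/
abbrev rangeG (G : L → K) (l : L) : Submodule ℝ (TangentSpace 𝓘(ℝ, F) (G l)) :=
  LinearMap.range (dmap (E := E) G l).toLinearMap

/-- The component of `w` in `range G_*`. -/
def tanPart (G : L → K) (l : L) (w : TangentSpace 𝓘(ℝ, F) (G l)) : TangentSpace 𝓘(ℝ, F) (G l) :=
  (rangeG (E := E) G l).starProjection w

/-- The component of `w` in `(range G_*)ᗮ`. -/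
def norPart (G : L → K) (l : L) (w : TangentSpace 𝓘(ℝ, F) (G l)) : TangentSpace 𝓘(ℝ, F) (G l) :=
  (rangeG (E := E) G l)ᗮ.starProjection w

/-- The adjoint `*G_*` of the differential with respect to the two Riemannian metrics. -/
def adjointMap (G : L → K) (l : L) :
    TangentSpace 𝓘(ℝ, F) (G l) →ₗ[ℝ] TangentSpace 𝓘(ℝ, E) l :=
  LinearMap.adjoint (dmap (E := E) G l).toLinearMap

/-- `Γ((ker G_*)ᗮ)`: the smooth vector fields on `L` which are horizontal. -/
def IsHorizontalField (G : L → K) (X : ∀ l : L, TangentSpace 𝓘(ℝ, E) l) : Prop :=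
  IsSmoothField X ∧ ∀ l, X l ∈ (kerG (F := F) G l)ᗮ

/-- `Γ((range G_*)ᗮ)`: the smooth vector fields along `G` which are normal to `range G_*`. -/
def IsNormalField (G : L → K) (P : ∀ l : L, TangentSpace 𝓘(ℝ, F) (G l)) : Prop :=
  ContMDiff 𝓘(ℝ, E) (𝓘(ℝ, F).prod 𝓘(ℝ, F)) ∞
      (fun l ↦ (⟨G l, P l⟩ : TangentBundle 𝓘(ℝ, F) K))
    ∧ ∀ l, P l ∈ (rangeG (E := E) G l)ᗮ

/-- The pullback `∇^G` of the Levi-Civita connection of `K`: for a vector field `W` along `G`,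
`pullbackCov G W l v` is `(∇^G_v W)(l)`, computed in the preferred chart of `K` at `G l`. -/
def pullbackCov (G : L → K) (W : ∀ l : L, TangentSpace 𝓘(ℝ, F) (G l)) (l : L)
    (v : TangentSpace 𝓘(ℝ, E) l) : TangentSpace 𝓘(ℝ, F) (G l) :=
  (trivializationAt F (TangentSpace 𝓘(ℝ, F)) (G l)).symmL ℝ (G l)
      (mvfderiv 𝓘(ℝ, E)
        (fun m : L ↦ (trivializationAt F (TangentSpace 𝓘(ℝ, F)) (G l) ⟨G m, W m⟩).2) l v)
    + christoffel (G l) (dmap G l v) (W l)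

/-- The connection `∇^{G⊥}` on `(range G_*)ᗮ`. -/
def normalCov (G : L → K) (V : ∀ l : L, TangentSpace 𝓘(ℝ, F) (G l)) (l : L)
    (v : TangentSpace 𝓘(ℝ, E) l) : TangentSpace 𝓘(ℝ, F) (G l) :=
  norPart (E := E) G l (pullbackCov G V l v)

/-- The second fundamental form `(∇G_*)(X, Y) = ∇^G_X G_*Y - G_*(∇^L_X Y)`. -/
def secondFundForm (G : L → K) (X Y : ∀ l : L, TangentSpace 𝓘(ℝ, E) l) (l : L) :
    TangentSpace 𝓘(ℝ, F) (G l) :=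
  pullbackCov G (pushField G Y) l (X l) - dmap G l (leviCivita Y l (X l))

/-- The `(range G_*)ᗮ`-component `(∇G_*)^⊥(X, Y)` of the second fundamental form. -/
def secondFundFormPerp (G : L → K) (X Y : ∀ l : L, TangentSpace 𝓘(ℝ, E) l) (l : L) :
    TangentSpace 𝓘(ℝ, F) (G l) :=
  norPart (E := E) G l (secondFundForm G X Y l)

/-- `G` is a conformal Riemannian map: smooth, and on horizontal vectors it scales the metric by
the square of a smooth positive function (the dilation). -/
def IsConformalRiemannianMap (G : L → K) : Prop :=
  ContMDiff 𝓘(ℝ, E) 𝓘(ℝ, F) ∞ G ∧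
  ∃ lam : L → ℝ, ContMDiff 𝓘(ℝ, E) 𝓘(ℝ, ℝ) ∞ lam ∧ (∀ l, 0 < lam l) ∧
    ∀ (l : L) (X Y : TangentSpace 𝓘(ℝ, E) l),
      X ∈ (kerG (F := F) G l)ᗮ → Y ∈ (kerG (F := F) G l)ᗮ →
        inner ℝ (dmap (F := F) G l X) (dmap (F := F) G l Y)
          = lam l ^ 2 * inner ℝ X Y

variable (φ : ∀ x : K, TangentSpace 𝓘(ℝ, F) x →L[ℝ] TangentSpace 𝓘(ℝ, F) x)

/-- The Wirtinger angle of `w`: the angle between `φ w` and the subspace `range G_*`, that is,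
between `φ w` and its orthogonal projection (it is `π / 2` if the projection is zero). -/
def wirtingerAngle (G : L → K) (l : L) (w : TangentSpace 𝓘(ℝ, F) (G l)) : ℝ :=
  InnerProductGeometry.angle (φ (G l) w) (tanPart (E := E) G l (φ (G l) w))

/-- `G` is a conformal pointwise-slant Riemannian map with slant function `Θ`: at each point the
Wirtinger angle is the same, `Θ l`, for all nonzero vectors of `range G_*`. -/
def IsCPSRM (G : L → K) (Θ : L → ℝ) : Prop :=
  IsConformalRiemannianMap (E := E) (F := F) G ∧
  ∀ (l : L), ∀ w ∈ rangeG (E := E) G l, w ≠ 0 → wirtingerAngle (E := E) φ G l w = Θ l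

/-- The slant function is proper: at no point the range is complex (`Θ = 0`) or totally real
(`Θ = π / 2`). -/
def IsProperSlant (Θ : L → ℝ) : Prop :=
  ∀ l, 0 < Θ l ∧ Θ l < Real.pi / 2

/-- `ρ W`: for `W` in `range G_*`, the tangential component of `φ W`. -/
def rho (G : L → K) (W : ∀ l : L, TangentSpace 𝓘(ℝ, F) (G l)) (l : L) :
    TangentSpace 𝓘(ℝ, F) (G l) :=
  tanPart (E := E) G l (φ (G l) (W l))

/-- `ϖ W`: for `W` in `range G_*`, the normal component of `φ W`. -/
def varpi (G : L → K) (W : ∀ l : L, TangentSpace 𝓘(ℝ, F) (G l)) (l : L) :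
    TangentSpace 𝓘(ℝ, F) (G l) :=
  norPart (E := E) G l (φ (G l) (W l))

/-- `𝒟 P`: for `P` in `(range G_*)ᗮ`, the tangential component of `φ P`. -/
def calD (G : L → K) (P : ∀ l : L, TangentSpace 𝓘(ℝ, F) (G l)) (l : L) :
    TangentSpace 𝓘(ℝ, F) (G l) :=
  tanPart (E := E) G l (φ (G l) (P l))

/-- `ℰ P`: for `P` in `(range G_*)ᗮ`, the normal component of `φ P`. -/
def calE (G : L → K) (P : ∀ l : L, TangentSpace 𝓘(ℝ, F) (G l)) (l : L) :
    TangentSpace 𝓘(ℝ, F) (G l) :=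
  norPart (E := E) G l (φ (G l) (P l))

/-- `range G_*` defines a totally geodesic foliation: the covariant derivative of a section
`G_* Z` of `range G_*` in a direction `G_* Y` of `range G_*` lies in `range G_*`. (Closedness under
brackets is part of this, since `[G_*Y, G_*Z] = ∇^G_Y G_*Z - ∇^G_Z G_*Y`.) -/
def RangeTotallyGeodesic (G : L → K) : Prop :=
  ∀ Y Z : ∀ l : L, TangentSpace 𝓘(ℝ, E) l,
    IsHorizontalField (F := F) G Y → IsHorizontalField (F := F) G Z →
      ∀ l, pullbackCov G (pushField (F := F) G Z) l (Y l) ∈ rangeG (E := E) G l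

end Maps

end ConformalSlant

end

open Bundle Manifold
open scoped ContDiff Manifold Topology

set_option linter.unusedSectionVars false

noncomputable section

/-! Write W = G_*Z and ∇ for the pullback connection. As φ is parallel and isometric, expanding
g(∇_Y W, P) = g(φ∇_Y W, φP) and using ρ² = -cos²Θ turns the right-hand side of the criterion into
sin²Θ g(∇_Y W, P) - g(𝒟P, ∇_Y ϖW) (`inner_pullbackCov_varpi_sub`). Conformality gives G_* *G_* = λ²
on the range, so by metric compatibility the left-hand side is -λ² g(𝒟P, ∇_Y ϖW). Hence the
criterion reads sin²Θ g(∇_Y W, P) = -(λ² - 1) g(𝒟P, ∇_Y ϖW).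

If the range is totally geodesic, both sides vanish: moving the derivative onto the tangent field
G_* *G_*𝒟P leaves a tangent vector paired with a normal one.

Conversely, put t = λ² - 1 and T(Y, Z, U) = g(∇_Y G_*Z, ϖG_*U). Taking P = ϖG_*U and using 𝒟ϖ =
-sin²Θ (`calD_varpi`), the criterion becomes T(Y, Z, U) = -t T(Y, U, Z). Torsion-freeness makes T
symmetric in Y, Z (`inner_pullbackCov_pushField_comm`). Alternating the two rules three times gives
T = -t³ T, and 1 + t³ = λ²(t² - t + 1) > 0, so T = 0. Since 𝒟P is tangent, g(𝒟P, ∇_Y ϖW) then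
vanishes for every normal P, and the criterion leaves sin²Θ g(∇_Y W, P) = 0 with sin Θ ≠ 0.

The chart computations establish metric compatibility, torsion-freeness and ∇φ = 0 along G;
smoothness of the projections onto the range comes from conformality. -/

namespace ConformalSlant

/-! ### Product rule and smoothness for operator-valued maps on a manifold. -/

section Calculus

variable {E : Type*} [NormedAddCommGroup E] [NormedSpace ℝ E]
  {M : Type*} [TopologicalSpace M] [ChartedSpace E M]
  {V : Type*} [NormedAddCommGroup V] [NormedSpace ℝ V]
  {W : Type*} [NormedAddCommGroup W] [NormedSpace ℝ W]

lemma mvfderiv_congr {f g : M → V} {x : M} (h : f =ᶠ[𝓝 x] g) :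
    mvfderiv 𝓘(ℝ, E) f x = mvfderiv 𝓘(ℝ, E) g x := by
  ext v
  have := h.mfderiv_eq (I := 𝓘(ℝ, E)) (I' := 𝓘(ℝ, V))
  simp only [mvfderiv, ContinuousLinearMap.comp_apply]
  exact congrArg (fun L : E →L[ℝ] V ↦ L v) this

/-- A family of linear maps on a finite-dimensional space is smooth if its values are. -/
lemma contMDiffAt_clm_of_apply [FiniteDimensional ℝ V] {n : WithTop ℕ∞} {A : M → V →L[ℝ] W} {x : M}
    (h : ∀ v, ContMDiffAt 𝓘(ℝ, E) 𝓘(ℝ, W) n (fun m ↦ A m v) x) :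
    ContMDiffAt 𝓘(ℝ, E) 𝓘(ℝ, V →L[ℝ] W) n A x := by
  let b := Module.finBasis ℝ V
  let c : Fin (Module.finrank ℝ V) → V →L[ℝ] ℝ := fun i ↦ (b.coord i).toContinuousLinearMap
  have hA : A = fun m ↦ ∑ i, ContinuousLinearMap.smulRightL ℝ V W (c i) (A m (b i)) := by
    funext m
    ext v
    have hv := congrArg (A m) (b.sum_repr v)
    rw [map_sum] at hv
    simp [c, ← hv]
  rw [hA]
  refine ContMDiffAt.sum fun i _ ↦ ?_
  exact (ContinuousLinearMap.contMDiff (ContinuousLinearMap.smulRightL ℝ V W (c i))).contMDiffAt.comp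
    x (h (b i))

lemma mvfderiv_clm_apply {A : M → V →L[ℝ] W} {c : M → V} {x : M}
    (hA : MDifferentiableAt 𝓘(ℝ, E) 𝓘(ℝ, V →L[ℝ] W) A x)
    (hc : MDifferentiableAt 𝓘(ℝ, E) 𝓘(ℝ, V) c x) (u : TangentSpace 𝓘(ℝ, E) x) :
    mvfderiv 𝓘(ℝ, E) (fun m ↦ A m (c m)) x u
      = mvfderiv 𝓘(ℝ, E) A x u (c x) + A x (mvfderiv 𝓘(ℝ, E) c x u) := by
  have hAc : MDifferentiableAt 𝓘(ℝ, E) 𝓘(ℝ, W) (fun m ↦ A m (c m)) x := hA.clm_apply hc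
  -- In the chart, the vector-space product rule and the manifold derivative describe the same
  -- function; uniqueness of derivatives identifies them.
  have h1 : HasFDerivWithinAt _ _ _ _ := hA.hasMFDerivAt.2
  have h2 : HasFDerivWithinAt _ _ _ _ := hc.hasMFDerivAt.2
  have h3 := h1.clm_apply h2
  have h4 : HasFDerivWithinAt _ _ _ _ := hAc.hasMFDerivAt.2
  have hu : UniqueDiffWithinAt ℝ (Set.range 𝓘(ℝ, E)) (extChartAt 𝓘(ℝ, E) x x) := by
    simp
  have h5 := congrArg (fun L : E →L[ℝ] W ↦ L u) (hu.eq h4 h3)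
  refine h5.trans ?_
  simp only [mfld_simps]
  rw [add_comm]
  simp [mvfderiv]
  rfl

lemma mvfderiv_clm_apply_const {A : M → V →L[ℝ] W} {x : M}
    (hA : MDifferentiableAt 𝓘(ℝ, E) 𝓘(ℝ, V →L[ℝ] W) A x) (c : V) (u : TangentSpace 𝓘(ℝ, E) x) :
    mvfderiv 𝓘(ℝ, E) (fun m ↦ A m c) x u = mvfderiv 𝓘(ℝ, E) A x u c := by
  rw [mvfderiv_clm_apply hA mdifferentiableAt_const u, mvfderiv_const]
  simp

end Calculus

/-! ### The metric and the Christoffel symbols in a chart. -/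

section LocalMetric

variable {F : Type*} [NormedAddCommGroup F] [NormedSpace ℝ F]
  {K : Type*} [TopologicalSpace K] [ChartedSpace F K] [IsManifold 𝓘(ℝ, F) ∞ K]

/-- The components of a tangent vector `w` at `y` in the preferred chart at `x`. -/
def components (x y : K) (w : TangentSpace 𝓘(ℝ, F) y) : F :=
  (trivializationAt F (TangentSpace 𝓘(ℝ, F)) x ⟨y, w⟩).2

/-- The tangent vector at `y` with given components in the preferred chart at `x`. -/
abbrev ofComponents (x y : K) : F →L[ℝ] TangentSpace 𝓘(ℝ, F) y :=
  (trivializationAt F (TangentSpace 𝓘(ℝ, F)) x).symmL ℝ y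

lemma components_eq_continuousLinearMapAt {x y : K} (hy : y ∈ (chartAt F x).source)
    (w : TangentSpace 𝓘(ℝ, F) y) :
    components x y w
      = (trivializationAt F (TangentSpace 𝓘(ℝ, F)) x).continuousLinearMapAt ℝ y w :=
  (Trivialization.continuousLinearMapAt_apply_of_mem (R := ℝ) _ hy w).symm

lemma ofComponents_components {x y : K} (hy : y ∈ (chartAt F x).source)
    (w : TangentSpace 𝓘(ℝ, F) y) : ofComponents x y (components x y w) = w := by
  rw [components_eq_continuousLinearMapAt hy]
  exact Trivialization.symmL_continuousLinearMapAt _ hy w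

lemma components_ofComponents {x y : K} (hy : y ∈ (chartAt F x).source) (a : F) :
    components x y (ofComponents x y a) = a := by
  rw [components_eq_continuousLinearMapAt hy]
  exact Trivialization.continuousLinearMapAt_symmL _ hy a

lemma components_add {x y : K} (hy : y ∈ (chartAt F x).source) (v w : TangentSpace 𝓘(ℝ, F) y) :
    components x y (v + w) = components x y v + components x y w := by
  simp only [components_eq_continuousLinearMapAt hy, map_add]

lemma components_smul {x y : K} (hy : y ∈ (chartAt F x).source) (c : ℝ)
    (w : TangentSpace 𝓘(ℝ, F) y) : components x y (c • w) = c • components x y w := by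
  simp only [components_eq_continuousLinearMapAt hy, map_smul]

/-- Makes the chain rule available for components. -/
lemma components_eq_mvfderiv {x y : K} (hy : y ∈ (chartAt F x).source)
    (w : TangentSpace 𝓘(ℝ, F) y) :
    components x y w = mvfderiv 𝓘(ℝ, F) (extChartAt 𝓘(ℝ, F) x) y w := by
  rw [components_eq_continuousLinearMapAt hy,
    TangentBundle.continuousLinearMapAt_trivializationAt hy]
  rfl

lemma contMDiffAt_ofComponents {x y : K} (hy : y ∈ (chartAt F x).source) (a : F) :
    ContMDiffAt 𝓘(ℝ, F) (𝓘(ℝ, F).prod 𝓘(ℝ, F)) ∞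
      (fun y ↦ (⟨y, ofComponents x y a⟩ : TangentBundle 𝓘(ℝ, F) K)) y := by
  rw [(trivializationAt F (TangentSpace 𝓘(ℝ, F)) x).contMDiffAt_iff (by simpa using hy)]
  refine ⟨contMDiffAt_id, contMDiffAt_const (c := a) |>.congr_of_eventuallyEq ?_⟩
  filter_upwards [(chartAt F x).open_source.mem_nhds hy] with z hz
  exact components_ofComponents hz a

variable [FiniteDimensional ℝ F] [RiemannianBundle (fun x : K ↦ TangentSpace 𝓘(ℝ, F) x)]

/-- The matrix of the metric at `y` in the preferred chart at `x`, as a bilinear form. -/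
def localMetric (x y : K) : F →L[ℝ] F →L[ℝ] ℝ :=
  (innerSL ℝ (E := TangentSpace 𝓘(ℝ, F) y)).bilinearComp (ofComponents x y) (ofComponents x y)

lemma localMetric_apply (x y : K) (a b : F) :
    localMetric x y a b = inner ℝ (ofComponents x y a) (ofComponents x y b) := rfl

variable [IsContMDiffRiemannianBundle 𝓘(ℝ, F) ∞ F (fun x : K ↦ TangentSpace 𝓘(ℝ, F) x)]

lemma contMDiffAt_inner_along {E : Type*} [NormedAddCommGroup E] [NormedSpace ℝ E]
    {L : Type*} [TopologicalSpace L] [ChartedSpace E L] {G : L → K}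
    {V W : ∀ l : L, TangentSpace 𝓘(ℝ, F) (G l)} {l : L}
    (hV : ContMDiffAt 𝓘(ℝ, E) (𝓘(ℝ, F).prod 𝓘(ℝ, F)) ∞
      (fun l ↦ (⟨G l, V l⟩ : TangentBundle 𝓘(ℝ, F) K)) l)
    (hW : ContMDiffAt 𝓘(ℝ, E) (𝓘(ℝ, F).prod 𝓘(ℝ, F)) ∞
      (fun l ↦ (⟨G l, W l⟩ : TangentBundle 𝓘(ℝ, F) K)) l) :
    ContMDiffAt 𝓘(ℝ, E) 𝓘(ℝ, ℝ) ∞ (fun l ↦ inner ℝ (V l) (W l)) l :=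
  ContMDiffAt.inner_bundle (E := fun x : K ↦ TangentSpace 𝓘(ℝ, F) x) (v := V) (w := W) hV hW

lemma contMDiffAt_localMetric {x y : K} (hy : y ∈ (chartAt F x).source) :
    ContMDiffAt 𝓘(ℝ, F) 𝓘(ℝ, F →L[ℝ] F →L[ℝ] ℝ) ∞ (localMetric (F := F) (K := K) x) y := by
  refine contMDiffAt_clm_of_apply fun a ↦ contMDiffAt_clm_of_apply fun b ↦ ?_
  exact contMDiffAt_inner_along (G := fun y : K ↦ y) (contMDiffAt_ofComponents hy a)
    (contMDiffAt_ofComponents hy b)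

/-- Differentiating a single map with values in bilinear forms makes linearity in `v` and `w`
evident. -/
lemma metricDeriv_eq (x : K) (u v w : TangentSpace 𝓘(ℝ, F) x) :
    metricDeriv x u v w
      = mvfderiv 𝓘(ℝ, F) (localMetric x) x u (components x x v) (components x x w) := by
  have h := (contMDiffAt_localMetric (mem_chart_source F x)).mdifferentiableAt
    (by simp : (∞ : WithTop ℕ∞) ≠ 0)
  have h' : MDifferentiableAt 𝓘(ℝ, F) 𝓘(ℝ, F →L[ℝ] ℝ)
      (fun y ↦ localMetric x y (components x x v)) x :=
    h.clm_apply mdifferentiableAt_const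
  rw [← mvfderiv_clm_apply_const h, ← mvfderiv_clm_apply_const h']
  rfl

lemma metricDeriv_comm (x : K) (u v w : TangentSpace 𝓘(ℝ, F) x) :
    metricDeriv x u v w = metricDeriv x u w v := by
  simp only [metricDeriv, real_inner_comm]

lemma metricDeriv_add_dir (x : K) (u u' v w : TangentSpace 𝓘(ℝ, F) x) :
    metricDeriv x (u + u') v w = metricDeriv x u v w + metricDeriv x u' v w :=
  map_add _ u u'

lemma metricDeriv_smul_dir (x : K) (c : ℝ) (u v w : TangentSpace 𝓘(ℝ, F) x) :
    metricDeriv x (c • u) v w = c * metricDeriv x u v w :=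
  map_smul _ c u

lemma metricDeriv_add_right (x : K) (u v w w' : TangentSpace 𝓘(ℝ, F) x) :
    metricDeriv x u v (w + w') = metricDeriv x u v w + metricDeriv x u v w' := by
  rw [metricDeriv_eq, metricDeriv_eq, metricDeriv_eq, components_add (mem_chart_source F x)]
  exact map_add _ _ _

lemma metricDeriv_smul_right (x : K) (c : ℝ) (u v w : TangentSpace 𝓘(ℝ, F) x) :
    metricDeriv x u v (c • w) = c * metricDeriv x u v w := by
  rw [metricDeriv_eq, metricDeriv_eq, components_smul (mem_chart_source F x)]
  exact map_smul _ _ _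

lemma metricDeriv_add_left (x : K) (u v v' w : TangentSpace 𝓘(ℝ, F) x) :
    metricDeriv x u (v + v') w = metricDeriv x u v w + metricDeriv x u v' w := by
  rw [metricDeriv_comm, metricDeriv_add_right, metricDeriv_comm x u w v, metricDeriv_comm x u w v']

/-- The definition prescribes these inner products on an orthonormal basis; the right-hand side is
linear in `w`, so they agree everywhere. -/
lemma inner_christoffel (x : K) (u v w : TangentSpace 𝓘(ℝ, F) x) :
    inner ℝ (christoffel x u v) w
      = (metricDeriv x u v w + metricDeriv x v u w - metricDeriv x w u v) / 2 := by
  let ℓ : TangentSpace 𝓘(ℝ, F) x →ₗ[ℝ] ℝ :=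
    { toFun := fun b ↦ (metricDeriv x u v b + metricDeriv x v u b - metricDeriv x b u v) / 2
      map_add' := fun a b ↦ by
        rw [metricDeriv_add_right, metricDeriv_add_right, metricDeriv_add_dir]
        ring
      map_smul' := fun c b ↦ by
        rw [metricDeriv_smul_right, metricDeriv_smul_right, metricDeriv_smul_dir, smul_eq_mul,
          RingHom.id_apply]
        ring }
  change _ = ℓ w
  let B := stdOrthonormalBasis ℝ (TangentSpace 𝓘(ℝ, F) x)
  conv_rhs => rw [← B.sum_repr' w, map_sum]
  rw [christoffel, sum_inner]
  refine Finset.sum_congr rfl fun i _ ↦ ?_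
  rw [inner_smul_left, map_smul, smul_eq_mul, mul_comm]
  rfl

lemma christoffel_add_right (x : K) (u v w : TangentSpace 𝓘(ℝ, F) x) :
    christoffel x u (v + w) = christoffel x u v + christoffel x u w := by
  refine ext_inner_right ℝ fun z ↦ ?_
  rw [inner_add_left, inner_christoffel, inner_christoffel, inner_christoffel,
    metricDeriv_add_left, metricDeriv_add_dir, metricDeriv_add_right]
  ring

lemma christoffel_comm (x : K) (u v : TangentSpace 𝓘(ℝ, F) x) :
    christoffel x u v = christoffel x v u := by
  refine ext_inner_right ℝ fun z ↦ ?_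
  rw [inner_christoffel, inner_christoffel, metricDeriv_comm x z u v]
  ring

/-- Metric compatibility for fields with constant components: four of the six terms in the two
Koszul expressions cancel. -/
lemma metricDeriv_eq_christoffel (x : K) (u v w : TangentSpace 𝓘(ℝ, F) x) :
    metricDeriv x u v w = inner ℝ (christoffel x u v) w + inner ℝ v (christoffel x u w) := by
  rw [real_inner_comm (christoffel x u w) v, inner_christoffel, inner_christoffel,
    metricDeriv_comm x w u v, metricDeriv_comm x v u w, metricDeriv_comm x u w v]
  ring

end LocalMetric

/-! ### Vector fields along G and metric compatibility of the pullback connection. -/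

section Along

variable {E : Type*} [NormedAddCommGroup E] [NormedSpace ℝ E]
  {L : Type*} [TopologicalSpace L] [ChartedSpace E L]
  {F : Type*} [NormedAddCommGroup F] [NormedSpace ℝ F]
  {K : Type*} [TopologicalSpace K] [ChartedSpace F K] [IsManifold 𝓘(ℝ, F) ∞ K]
  {G : L → K}

/-- The smooth vector fields along `G`. -/
def IsSmoothAlong (G : L → K) (V : ∀ l : L, TangentSpace 𝓘(ℝ, F) (G l)) : Prop :=
  ContMDiff 𝓘(ℝ, E) (𝓘(ℝ, F).prod 𝓘(ℝ, F)) ∞ (fun l ↦ (⟨G l, V l⟩ : TangentBundle 𝓘(ℝ, F) K))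

namespace IsSmoothAlong

variable {V W : ∀ l : L, TangentSpace 𝓘(ℝ, F) (G l)}

lemma contMDiff_base (hV : IsSmoothAlong (E := E) G V) : ContMDiff 𝓘(ℝ, E) 𝓘(ℝ, F) ∞ G :=
  fun l ↦ (contMDiffAt_totalSpace.1 (hV l)).1

lemma contMDiffAt_components (hV : IsSmoothAlong (E := E) G V) (l : L) :
    ContMDiffAt 𝓘(ℝ, E) 𝓘(ℝ, F) ∞ (fun m ↦ components (G l) (G m) (V m)) l :=
  (contMDiffAt_totalSpace.1 (hV l)).2

lemma mdifferentiableAt_components (hV : IsSmoothAlong (E := E) G V) (l : L) :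
    MDifferentiableAt 𝓘(ℝ, E) 𝓘(ℝ, F) (fun m ↦ components (G l) (G m) (V m)) l :=
  (hV.contMDiffAt_components l).mdifferentiableAt (by simp)

end IsSmoothAlong

variable {V W : ∀ l : L, TangentSpace 𝓘(ℝ, F) (G l)}

lemma eventually_mem_chart_source (hG : ContMDiff 𝓘(ℝ, E) 𝓘(ℝ, F) ∞ G) (l : L) :
    ∀ᶠ m in 𝓝 l, G m ∈ (chartAt F (G l)).source :=
  hG.continuous.continuousAt ((chartAt F (G l)).open_source.mem_nhds (mem_chart_source F (G l)))

lemma isSmoothAlong_of_components (hG : ContMDiff 𝓘(ℝ, E) 𝓘(ℝ, F) ∞ G)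
    (h : ∀ l, ContMDiffAt 𝓘(ℝ, E) 𝓘(ℝ, F) ∞ (fun m ↦ components (G l) (G m) (V m)) l) :
    IsSmoothAlong (E := E) G V :=
  fun l ↦ contMDiffAt_totalSpace.2 ⟨hG l, h l⟩

namespace IsSmoothAlong

lemma add (hV : IsSmoothAlong (E := E) G V) (hW : IsSmoothAlong (E := E) G W) :
    IsSmoothAlong (E := E) G (fun l ↦ V l + W l) := by
  refine isSmoothAlong_of_components hV.contMDiff_base fun l ↦ ?_
  refine ((hV.contMDiffAt_components l).add (hW.contMDiffAt_components l)).congr_of_eventuallyEq ?_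
  filter_upwards [eventually_mem_chart_source hV.contMDiff_base l] with m hm
  exact components_add hm _ _

lemma smul {c : L → ℝ} (hc : ContMDiff 𝓘(ℝ, E) 𝓘(ℝ, ℝ) ∞ c) (hV : IsSmoothAlong (E := E) G V) :
    IsSmoothAlong (E := E) G (fun l ↦ c l • V l) := by
  refine isSmoothAlong_of_components hV.contMDiff_base fun l ↦ ?_
  refine ((hc l).smul (hV.contMDiffAt_components l)).congr_of_eventuallyEq ?_
  filter_upwards [eventually_mem_chart_source hV.contMDiff_base l] with m hm
  exact components_smul hm _ _

lemma sub (hV : IsSmoothAlong (E := E) G V) (hW : IsSmoothAlong (E := E) G W) :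
    IsSmoothAlong (E := E) G (fun l ↦ V l - W l) := by
  have := hV.add (hW.smul (c := fun _ ↦ -1) contMDiff_const)
  simpa [sub_eq_add_neg] using this

end IsSmoothAlong

variable [FiniteDimensional ℝ F] [RiemannianBundle (fun x : K ↦ TangentSpace 𝓘(ℝ, F) x)]

lemma IsSmoothAlong.apply_kaehler (hV : IsSmoothAlong (E := E) G V)
    {φ : ∀ x : K, TangentSpace 𝓘(ℝ, F) x →L[ℝ] TangentSpace 𝓘(ℝ, F) x} (hφ : IsKaehler φ) :
    IsSmoothAlong (E := E) G (fun l ↦ φ (G l) (V l)) := by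
  intro l
  refine ContMDiffAt.clm_bundle_apply (F₁ := F) (F₂ := F)
    (E₁ := fun x : K ↦ TangentSpace 𝓘(ℝ, F) x) (E₂ := fun x : K ↦ TangentSpace 𝓘(ℝ, F) x)
    (b := G) (ϕ := fun l ↦ φ (G l)) (v := V) ?_ (hV l)
  exact hφ.smooth.contMDiffAt.comp l (hV.contMDiff_base l)

lemma pullbackCov_eq (G : L → K) (V : ∀ l : L, TangentSpace 𝓘(ℝ, F) (G l)) (l : L)
    (v : TangentSpace 𝓘(ℝ, E) l) :
    pullbackCov G V l v
      = ofComponents (G l) (G l) (mvfderiv 𝓘(ℝ, E) (fun m ↦ components (G l) (G m) (V m)) l v)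
        + christoffel (G l) (dmap G l v) (V l) := rfl

variable [IsContMDiffRiemannianBundle 𝓘(ℝ, F) ∞ F (fun x : K ↦ TangentSpace 𝓘(ℝ, F) x)]

lemma pullbackCov_add (hV : IsSmoothAlong (E := E) G V) (hW : IsSmoothAlong (E := E) G W) (l : L)
    (v : TangentSpace 𝓘(ℝ, E) l) :
    pullbackCov G (fun m ↦ V m + W m) l v = pullbackCov G V l v + pullbackCov G W l v := by
  have h : (fun m ↦ components (G l) (G m) (V m + W m)) =ᶠ[𝓝 l]
      (fun m ↦ components (G l) (G m) (V m) + components (G l) (G m) (W m)) := by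
    filter_upwards [eventually_mem_chart_source hV.contMDiff_base l] with m hm
    exact components_add hm _ _
  rw [pullbackCov_eq, pullbackCov_eq, pullbackCov_eq, christoffel_add_right, mvfderiv_congr h,
    mvfderiv_fun_add (hV.mdifferentiableAt_components l) (hW.mdifferentiableAt_components l),
    add_apply, map_add]
  abel

/-- The pullback connection is compatible with the metric. -/
lemma mvfderiv_inner_eq (hV : IsSmoothAlong (E := E) G V) (hW : IsSmoothAlong (E := E) G W) (l : L)
    (v : TangentSpace 𝓘(ℝ, E) l) :
    mvfderiv 𝓘(ℝ, E) (fun m ↦ (inner ℝ (V m) (W m) : ℝ)) l v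
      = inner ℝ (pullbackCov G V l v) (W l) + inner ℝ (V l) (pullbackCov G W l v) := by
  have hG := hV.contMDiff_base
  have hx := mem_chart_source F (G l)
  have hGd : MDifferentiableAt 𝓘(ℝ, E) 𝓘(ℝ, F) G l := (hG l).mdifferentiableAt (by simp)
  have hg : MDifferentiableAt 𝓘(ℝ, F) 𝓘(ℝ, F →L[ℝ] F →L[ℝ] ℝ)
      (localMetric (F := F) (K := K) (G l)) (G l) :=
    (contMDiffAt_localMetric hx).mdifferentiableAt (by simp)
  have hg' : MDifferentiableAt 𝓘(ℝ, E) 𝓘(ℝ, F →L[ℝ] F →L[ℝ] ℝ)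
      (fun m ↦ localMetric (F := F) (K := K) (G l) (G m)) l := hg.comp l hGd
  -- In components the inner product is trilinear in (metric matrix, V, W). Two product rules give
  -- three terms, and the derivative of the matrix supplies both Christoffel corrections.
  have h : (fun m ↦ (inner ℝ (V m) (W m) : ℝ)) =ᶠ[𝓝 l]
      (fun m ↦ localMetric (G l) (G m) (components (G l) (G m) (V m))
        (components (G l) (G m) (W m))) := by
    filter_upwards [eventually_mem_chart_source hG l] with m hm
    rw [localMetric_apply, ofComponents_components hm, ofComponents_components hm]
  have hV' := hV.mdifferentiableAt_components l
  have hW' := hW.mdifferentiableAt_components l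
  have hgV : MDifferentiableAt 𝓘(ℝ, E) 𝓘(ℝ, F →L[ℝ] ℝ)
      (fun m ↦ localMetric (G l) (G m) (components (G l) (G m) (V m))) l := hg'.clm_apply hV'
  have hcomp : mvfderiv 𝓘(ℝ, E) (fun m ↦ localMetric (F := F) (K := K) (G l) (G m)) l v
      = mvfderiv 𝓘(ℝ, F) (localMetric (F := F) (K := K) (G l)) (G l) (dmap G l v) :=
    mfderiv_comp_apply l hg hGd v
  rw [mvfderiv_congr h, mvfderiv_clm_apply hgV hW', mvfderiv_clm_apply hg' hV', hcomp,
    pullbackCov_eq, pullbackCov_eq, inner_add_left, inner_add_right, add_apply, ← metricDeriv_eq,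
    metricDeriv_eq_christoffel, localMetric_apply, localMetric_apply,
    ofComponents_components hx, ofComponents_components hx]
  ring

/-- If `V` and `W` are orthogonal, the covariant derivative can be moved from one to the other. -/
lemma inner_pullbackCov_eq_neg (hV : IsSmoothAlong (E := E) G V) (hW : IsSmoothAlong (E := E) G W)
    (h : ∀ m, inner ℝ (V m) (W m) = (0 : ℝ)) (l : L) (v : TangentSpace 𝓘(ℝ, E) l) :
    inner ℝ (pullbackCov G V l v) (W l) = -inner ℝ (V l) (pullbackCov G W l v) := by
  have h1 := mvfderiv_inner_eq hV hW l v
  simp only [h, mvfderiv_const] at h1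
  have h2 : (0 : ℝ) = inner ℝ (pullbackCov G V l v) (W l)
    + inner ℝ (V l) (pullbackCov G W l v) := h1
  linarith

end Along

/-! ### Extending tangent vectors to global smooth fields. -/

section Extension

variable {F : Type*} [NormedAddCommGroup F] [NormedSpace ℝ F] [FiniteDimensional ℝ F]
  {K : Type*} [TopologicalSpace K] [T2Space K] [ChartedSpace F K] [IsManifold 𝓘(ℝ, F) ∞ K]

/-- A field with constant components near `x` extends to a smooth vector field. -/
lemma exists_isSmoothField_eventuallyEq (x : K) (a : F) :
    ∃ Y : ∀ y : K, TangentSpace 𝓘(ℝ, F) y, IsSmoothField Y ∧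
      ∀ᶠ y in 𝓝 x, Y y = ofComponents x y a := by
  let f : SmoothBumpFunction 𝓘(ℝ, F) x := Classical.arbitrary _
  refine ⟨fun y ↦ f y • ofComponents x y a, fun y ↦ ?_, ?_⟩
  · refine (contMDiffAt_section y).2 ?_
    have hy' := mem_chart_source F y
    -- The support lies in the chart domain, where the coordinate field is smooth; off the support
    -- the product vanishes locally.
    by_cases hy : y ∈ tsupport f
    · have hyx := f.tsupport_subset_chartAt_source hy
      have h := (contMDiffAt_section y).1 (contMDiffAt_ofComponents hyx a)
      refine ((f.contMDiff.contMDiffAt (x := y)).smul h).congr_of_eventuallyEq ?_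
      filter_upwards [(chartAt F y).open_source.mem_nhds hy'] with z hz
      exact components_smul hz _ _
    · refine (contMDiffAt_const (c := (0 : F))).congr_of_eventuallyEq ?_
      filter_upwards [(isClosed_tsupport f).isOpen_compl.mem_nhds hy,
        (chartAt F y).open_source.mem_nhds hy'] with z hz hzy
      have h0 : f z = 0 := image_eq_zero_of_notMem_tsupport hz
      have := components_smul hzy 0 (ofComponents x z a)
      rw [zero_smul ℝ (components _ _ _)] at this
      rw [h0]
      exact this
  · filter_upwards [f.eventuallyEq_one] with y hy
    rw [hy]
    simp

/-- Every tangent vector extends to a smooth vector field. -/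
lemma exists_isSmoothField_apply_eq (x : K) (v : TangentSpace 𝓘(ℝ, F) x) :
    ∃ Y : ∀ y : K, TangentSpace 𝓘(ℝ, F) y, IsSmoothField Y ∧ Y x = v := by
  obtain ⟨Y, hY, h⟩ := exists_isSmoothField_eventuallyEq x (components x x v)
  exact ⟨Y, hY, h.self_of_nhds.trans (ofComponents_components (mem_chart_source F x) v)⟩

end Extension

/-! ### Transferring ∇φ = 0 from fields on K to fields along G. -/

section Parallel

variable {F : Type*} [NormedAddCommGroup F] [NormedSpace ℝ F] [FiniteDimensional ℝ F]
  {K : Type*} [TopologicalSpace K] [ChartedSpace F K] [IsManifold 𝓘(ℝ, F) ∞ K]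
  [RiemannianBundle (fun x : K ↦ TangentSpace 𝓘(ℝ, F) x)]

lemma leviCivita_congr {V W : ∀ y : K, TangentSpace 𝓘(ℝ, F) y} {x : K}
    (h : ∀ᶠ y in 𝓝 x, V y = W y) (u : TangentSpace 𝓘(ℝ, F) x) :
    leviCivita V x u = leviCivita W x u := by
  have h' : (fun y ↦ (trivializationAt F (TangentSpace 𝓘(ℝ, F)) x ⟨y, V y⟩).2) =ᶠ[𝓝 x]
      (fun y ↦ (trivializationAt F (TangentSpace 𝓘(ℝ, F)) x ⟨y, W y⟩).2) := by
    filter_upwards [h] with y hy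
    rw [hy]
  rw [leviCivita, leviCivita, mvfderiv_congr h', h.self_of_nhds]

variable (φ : ∀ x : K, TangentSpace 𝓘(ℝ, F) x →L[ℝ] TangentSpace 𝓘(ℝ, F) x)

/-- The matrix of `φ` at `y` in the preferred chart at `x`. -/
def localEndo (x y : K) : F →L[ℝ] F :=
  ((trivializationAt F (TangentSpace 𝓘(ℝ, F)) x).continuousLinearMapAt ℝ y).comp
    ((φ y).comp (ofComponents x y))

lemma localEndo_apply {x y : K} (hy : y ∈ (chartAt F x).source) (a : F) :
    localEndo φ x y a = components x y (φ y (ofComponents x y a)) :=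
  (components_eq_continuousLinearMapAt hy _).symm

variable {φ}

lemma contMDiffAt_localEndo (hφ : IsKaehler φ) (x : K) :
    ContMDiffAt 𝓘(ℝ, F) 𝓘(ℝ, F →L[ℝ] F) ∞ (localEndo φ x) x :=
  ((contMDiffAt_hom_bundle (E₁ := fun x : K ↦ TangentSpace 𝓘(ℝ, F) x)
    (E₂ := fun x : K ↦ TangentSpace 𝓘(ℝ, F) x) _).1 (hφ.smooth x)).2

variable [T2Space K] [IsContMDiffRiemannianBundle 𝓘(ℝ, F) ∞ F (fun x : K ↦ TangentSpace 𝓘(ℝ, F) x)]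

/-- A Kähler structure is parallel: the derivative of its matrix is a commutator with the
Christoffel symbols. -/
lemma IsKaehler.mvfderiv_localEndo (hφ : IsKaehler φ) (x : K) (u : TangentSpace 𝓘(ℝ, F) x) (a : F) :
    ofComponents x x (mvfderiv 𝓘(ℝ, F) (localEndo φ x) x u a)
        + christoffel x u (φ x (ofComponents x x a))
      = φ x (christoffel x u (ofComponents x x a)) := by
  obtain ⟨X, hX, hXu⟩ := exists_isSmoothField_apply_eq x u
  -- A field along G need not come from a field on K, so parallelism is first reduced to an identity
  -- at a point. With constant components near `x`, the derivative term of ∇Y vanishes and only the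
  -- Christoffel term remains.
  obtain ⟨Y, hY, hYa⟩ := exists_isSmoothField_eventuallyEq x a
  have h := hφ.parallel X Y hX hY x
  have hYφ : ∀ᶠ y in 𝓝 x, φ y (Y y) = φ y (ofComponents x y a) := hYa.mono fun y hy ↦ by rw [hy]
  rw [hXu, leviCivita_congr hYa, leviCivita_congr hYφ, sub_eq_zero] at h
  have hs := (chartAt F x).open_source.mem_nhds (mem_chart_source F x)
  have h1 : (fun y ↦ (trivializationAt F (TangentSpace 𝓘(ℝ, F)) x
      ⟨y, φ y (ofComponents x y a)⟩).2) =ᶠ[𝓝 x] fun y ↦ localEndo φ x y a := by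
    filter_upwards [hs] with y hy
    exact (localEndo_apply φ hy a).symm
  have h2 : (fun y ↦ (trivializationAt F (TangentSpace 𝓘(ℝ, F)) x
      ⟨y, ofComponents x y a⟩).2) =ᶠ[𝓝 x] fun _ ↦ a := by
    filter_upwards [hs] with y hy
    exact components_ofComponents hy a
  have hd : MDifferentiableAt 𝓘(ℝ, F) 𝓘(ℝ, F →L[ℝ] F) (localEndo φ x) x :=
    (contMDiffAt_localEndo hφ x).mdifferentiableAt (by simp)
  rw [leviCivita, leviCivita, mvfderiv_congr h1, mvfderiv_congr h2, mvfderiv_const,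
    mvfderiv_clm_apply_const hd, zero_apply, map_zero, zero_add] at h
  exact h

variable {E : Type*} [NormedAddCommGroup E] [NormedSpace ℝ E]
  {L : Type*} [TopologicalSpace L] [ChartedSpace E L] {G : L → K}
  {V : ∀ l : L, TangentSpace 𝓘(ℝ, F) (G l)}

/-- A Kähler structure is parallel for the pullback connection. -/
lemma IsKaehler.pullbackCov_apply (hφ : IsKaehler φ) (hV : IsSmoothAlong (E := E) G V) (l : L)
    (v : TangentSpace 𝓘(ℝ, E) l) :
    pullbackCov G (fun m ↦ φ (G m) (V m)) l v = φ (G l) (pullbackCov G V l v) := by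
  have hG := hV.contMDiff_base
  have hx := mem_chart_source F (G l)
  have hGd : MDifferentiableAt 𝓘(ℝ, E) 𝓘(ℝ, F) G l := (hG l).mdifferentiableAt (by simp)
  have hd : MDifferentiableAt 𝓘(ℝ, F) 𝓘(ℝ, F →L[ℝ] F) (localEndo φ (G l)) (G l) :=
    (contMDiffAt_localEndo hφ (G l)).mdifferentiableAt (by simp)
  have hd' : MDifferentiableAt 𝓘(ℝ, E) 𝓘(ℝ, F →L[ℝ] F) (fun m ↦ localEndo φ (G l) (G m)) l :=
    hd.comp l hGd
  have hcomp : mvfderiv 𝓘(ℝ, E) (fun m ↦ localEndo φ (G l) (G m)) l v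
      = mvfderiv 𝓘(ℝ, F) (localEndo φ (G l)) (G l) (dmap G l v) :=
    mfderiv_comp_apply l hd hGd v
  have h : (fun m ↦ components (G l) (G m) (φ (G m) (V m))) =ᶠ[𝓝 l]
      fun m ↦ localEndo φ (G l) (G m) (components (G l) (G m) (V m)) := by
    filter_upwards [eventually_mem_chart_source hG l] with m hm
    rw [localEndo_apply φ hm, ofComponents_components hm]
  have key := hφ.mvfderiv_localEndo (G l) (dmap G l v) (components (G l) (G l) (V l))
  rw [ofComponents_components hx] at key
  rw [pullbackCov_eq, pullbackCov_eq, mvfderiv_congr h,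
    mvfderiv_clm_apply hd' (hV.mdifferentiableAt_components l), hcomp, map_add, map_add, ← key,
    localEndo_apply φ hx, ofComponents_components hx]
  abel

end Parallel

/-! ### The differential in charts, and symmetry of ∇_Y G_*Z modulo the range. -/

section Torsion

variable {E : Type*} [NormedAddCommGroup E] [NormedSpace ℝ E]
  {L : Type*} [TopologicalSpace L] [ChartedSpace E L] [IsManifold 𝓘(ℝ, E) ∞ L]
  {F : Type*} [NormedAddCommGroup F] [NormedSpace ℝ F]
  {K : Type*} [TopologicalSpace K] [ChartedSpace F K] [IsManifold 𝓘(ℝ, F) ∞ K]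
  {G : L → K}

/-- In charts, the differential of `G` is given by the derivative of the coordinate expression. -/
lemma eventually_components_dmap (hG : ContMDiff 𝓘(ℝ, E) 𝓘(ℝ, F) ∞ G) (l : L) :
    ∀ᶠ m in 𝓝 l, ∀ z : TangentSpace 𝓘(ℝ, E) m,
      components (G l) (G m) (dmap G m z)
        = fderiv ℝ (writtenInExtChartAt 𝓘(ℝ, E) 𝓘(ℝ, F) l G) (extChartAt 𝓘(ℝ, E) l m)
          (components l m z) := by
  have hs := (chartAt E l).open_source.mem_nhds (mem_chart_source E l)
  filter_upwards [hs, eventually_mem_chart_source hG l] with m hm hGm z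
  have hGd : MDifferentiableAt 𝓘(ℝ, E) 𝓘(ℝ, F) G m := (hG m).mdifferentiableAt (by simp)
  have he : MDifferentiableAt 𝓘(ℝ, E) 𝓘(ℝ, E) (extChartAt 𝓘(ℝ, E) l) m :=
    mdifferentiableAt_extChartAt hm
  have he' : MDifferentiableAt 𝓘(ℝ, F) 𝓘(ℝ, F) (extChartAt 𝓘(ℝ, F) (G l)) (G m) :=
    mdifferentiableAt_extChartAt hGm
  have hsymm : MDifferentiableAt 𝓘(ℝ, E) 𝓘(ℝ, E) (extChartAt 𝓘(ℝ, E) l).symm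
      (extChartAt 𝓘(ℝ, E) l m) := by
    have := (contMDiffOn_extChartAt_symm (I := 𝓘(ℝ, E)) (n := ∞) l).contMDiffAt
      ((isOpen_extChartAt_target l).mem_nhds
        ((extChartAt 𝓘(ℝ, E) l).map_source (by simpa using hm)))
    exact this.mdifferentiableAt (by simp)
  have hinv : (extChartAt 𝓘(ℝ, E) l).symm (extChartAt 𝓘(ℝ, E) l m) = m :=
    (extChartAt 𝓘(ℝ, E) l).left_inv (by simpa using hm)
  have hH : MDifferentiableAt 𝓘(ℝ, E) 𝓘(ℝ, F) (writtenInExtChartAt 𝓘(ℝ, E) 𝓘(ℝ, F) l G)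
      (extChartAt 𝓘(ℝ, E) l m) := by
    refine MDifferentiableAt.comp (I' := 𝓘(ℝ, F)) _ (g := extChartAt 𝓘(ℝ, F) (G l))
      (f := G ∘ (extChartAt 𝓘(ℝ, E) l).symm) ?_ ?_
    · rw [Function.comp_apply, hinv]
      exact he'
    · refine MDifferentiableAt.comp (I' := 𝓘(ℝ, E)) _ ?_ hsymm
      rwa [hinv]
  have hloc : (extChartAt 𝓘(ℝ, F) (G l)) ∘ G =ᶠ[𝓝 m]
      (writtenInExtChartAt 𝓘(ℝ, E) 𝓘(ℝ, F) l G) ∘ (extChartAt 𝓘(ℝ, E) l) := by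
    filter_upwards [(chartAt E l).open_source.mem_nhds hm] with p hp
    have : (extChartAt 𝓘(ℝ, E) l).symm (extChartAt 𝓘(ℝ, E) l p) = p :=
      (extChartAt 𝓘(ℝ, E) l).left_inv (by simpa using hp)
    simp only [writtenInExtChartAt, Function.comp_apply, this]
  rw [components_eq_mvfderiv hGm, components_eq_mvfderiv hm, ← mfderiv_eq_fderiv]
  have h1 := mfderiv_comp_apply m he' hGd z
  have h2 := mfderiv_comp_apply m hH he z
  have h3 := congrArg (fun A : E →L[ℝ] F ↦ A z)
    (hloc.mfderiv_eq (I := 𝓘(ℝ, E)) (I' := 𝓘(ℝ, F)))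
  exact h1.symm.trans (h3.trans h2)

lemma IsSmoothAlong.pushField {X : ∀ l : L, TangentSpace 𝓘(ℝ, E) l} (hX : IsSmoothField X)
    (hG : ContMDiff 𝓘(ℝ, E) 𝓘(ℝ, F) ∞ G) : IsSmoothAlong (E := E) G (pushField (F := F) G X) :=
  (hG.contMDiff_tangentMap (m := ∞) (by simp)).comp hX

lemma contDiffAt_writtenInExtChartAt (hG : ContMDiff 𝓘(ℝ, E) 𝓘(ℝ, F) ∞ G) (l : L) :
    ContDiffAt ℝ ∞ (writtenInExtChartAt 𝓘(ℝ, E) 𝓘(ℝ, F) l G) (extChartAt 𝓘(ℝ, E) l l) := by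
  have h := (contMDiffAt_iff.1 (hG l)).2
  rw [modelWithCornersSelf_coe, Set.range_id, contDiffWithinAt_univ] at h
  exact h

variable [FiniteDimensional ℝ F] [RiemannianBundle (fun x : K ↦ TangentSpace 𝓘(ℝ, F) x)]

/-- The covariant derivative of `G_* Z` in the direction `v`, in charts. -/
lemma pullbackCov_pushField (hG : ContMDiff 𝓘(ℝ, E) 𝓘(ℝ, F) ∞ G)
    {Z : ∀ l : L, TangentSpace 𝓘(ℝ, E) l} (hZ : IsSmoothField Z) (l : L)
    (v : TangentSpace 𝓘(ℝ, E) l) :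
    pullbackCov G (pushField G Z) l v
      = ofComponents (G l) (G l)
          (fderiv ℝ (fderiv ℝ (writtenInExtChartAt 𝓘(ℝ, E) 𝓘(ℝ, F) l G)) (extChartAt 𝓘(ℝ, E) l l)
            (components l l v) (components l l (Z l)))
        + dmap G l (ofComponents l l (mvfderiv 𝓘(ℝ, E) (fun m ↦ components l m (Z m)) l v))
        + christoffel (G l) (dmap G l v) (dmap G l (Z l)) := by
  set H := writtenInExtChartAt 𝓘(ℝ, E) 𝓘(ℝ, F) l G
  have hl := mem_chart_source E l
  have hC : ContDiffAt ℝ ∞ (fderiv ℝ H) (extChartAt 𝓘(ℝ, E) l l) :=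
    (contDiffAt_writtenInExtChartAt hG l).fderiv_right (by simp)
  have hC' : MDifferentiableAt 𝓘(ℝ, E) 𝓘(ℝ, E →L[ℝ] F) (fderiv ℝ H) (extChartAt 𝓘(ℝ, E) l l) :=
    (hC.differentiableAt (by simp)).mdifferentiableAt
  have he : MDifferentiableAt 𝓘(ℝ, E) 𝓘(ℝ, E) (extChartAt 𝓘(ℝ, E) l) l :=
    mdifferentiableAt_extChartAt hl
  have hd : MDifferentiableAt 𝓘(ℝ, E) 𝓘(ℝ, E →L[ℝ] F)
      (fun m ↦ fderiv ℝ H (extChartAt 𝓘(ℝ, E) l m)) l := hC'.comp l he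
  have hcomp : mvfderiv 𝓘(ℝ, E) (fun m ↦ fderiv ℝ H (extChartAt 𝓘(ℝ, E) l m)) l v
      = fderiv ℝ (fderiv ℝ H) (extChartAt 𝓘(ℝ, E) l l) (components l l v) := by
    rw [components_eq_mvfderiv hl, ← mfderiv_eq_fderiv]
    exact mfderiv_comp_apply l hC' he v
  have hZ' : MDifferentiableAt 𝓘(ℝ, E) 𝓘(ℝ, E) (fun m ↦ components l m (Z m)) l :=
    IsSmoothAlong.mdifferentiableAt_components (G := fun m : L ↦ m) hZ l
  have hev := eventually_components_dmap hG l
  have h : (fun m ↦ components (G l) (G m) (pushField G Z m)) =ᶠ[𝓝 l]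
      fun m ↦ fderiv ℝ H (extChartAt 𝓘(ℝ, E) l m) (components l m (Z m)) := by
    filter_upwards [hev] with m hm
    exact hm (Z m)
  -- Recognises the first-order term DH(dZ(v)) as `dmap` of a tangent vector of L.
  have hl' := hev.self_of_nhds
    (ofComponents l l (mvfderiv 𝓘(ℝ, E) (fun m ↦ components l m (Z m)) l v))
  rw [components_ofComponents hl] at hl'
  rw [pullbackCov_eq, mvfderiv_congr h, mvfderiv_clm_apply hd hZ', hcomp, map_add, ← hl',
    ofComponents_components (mem_chart_source F (G l))]
  rfl

variable [IsContMDiffRiemannianBundle 𝓘(ℝ, F) ∞ F (fun x : K ↦ TangentSpace 𝓘(ℝ, F) x)]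

/-- The pullback connection is torsion-free: modulo the range of the differential,
`∇_Y G_* Z` is symmetric in `Y` and `Z`. -/
lemma pullbackCov_pushField_sub_mem (hG : ContMDiff 𝓘(ℝ, E) 𝓘(ℝ, F) ∞ G)
    {Y Z : ∀ l : L, TangentSpace 𝓘(ℝ, E) l} (hY : IsSmoothField Y) (hZ : IsSmoothField Z) (l : L) :
    pullbackCov G (pushField (F := F) G Z) l (Y l) - pullbackCov G (pushField G Y) l (Z l)
      ∈ rangeG (E := E) G l := by
  have hsymm : IsSymmSndFDerivAt ℝ (writtenInExtChartAt 𝓘(ℝ, E) 𝓘(ℝ, F) l G)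
      (extChartAt 𝓘(ℝ, E) l l) :=
    (contDiffAt_writtenInExtChartAt hG l).isSymmSndFDerivAt
      (by rw [minSmoothness_of_isRCLikeNormedField]; exact ENat.LEInfty.out)
  rw [pullbackCov_pushField hG hZ, pullbackCov_pushField hG hY,
    hsymm.eq (components l l (Y l)), christoffel_comm (G l) (dmap G l (Y l))]
  -- The second derivatives and the Christoffel terms cancel; what is left is G_* of the bracket of
  -- Y and Z in coordinates.
  rw [add_sub_add_right_eq_sub, add_sub_add_left_eq_sub, ← map_sub]
  exact LinearMap.mem_range_self _ _

end Torsion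

/-! ### Linear algebra of a slant subspace. -/

section SlantAlgebra

variable {V : Type*} [NormedAddCommGroup V] [InnerProductSpace ℝ V] [FiniteDimensional ℝ V]
  (R : Submodule ℝ V) {J : V →ₗ[ℝ] V}

lemma inner_complexStructure_left (hJ : ∀ v, J (J v) = -v)
    (hJi : ∀ v w, inner ℝ (J v) (J w) = (inner ℝ v w : ℝ)) (v w : V) :
    inner ℝ (J v) w = (-inner ℝ v (J w) : ℝ) := by
  rw [← hJi (J v) w, hJ, inner_neg_left]

lemma inner_starProjection_left_of_mem {w : V} (hw : w ∈ R) (v : V) :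
    inner ℝ (R.starProjection v) w = (inner ℝ v w : ℝ) := by
  rw [Submodule.inner_starProjection_left_eq_right, Submodule.starProjection_eq_self_iff.2 hw]

lemma starProjection_add_orthogonal (v : V) :
    R.starProjection v + Rᗮ.starProjection v = v :=
  R.starProjection_add_starProjection_orthogonal v

/-- On a slant subspace, the square of the tangential part of `J` is a multiple of the identity. -/
lemma starProjection_sq_of_slant (hJ : ∀ v, J (J v) = -v)
    (hJi : ∀ v w, inner ℝ (J v) (J w) = (inner ℝ v w : ℝ)) {c : ℝ}
    (hc : ∀ w ∈ R, ‖R.starProjection (J w)‖ = c * ‖w‖) {w : V} (hw : w ∈ R) :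
    R.starProjection (J (R.starProjection (J w))) = -(c ^ 2 • w) := by
  have hsq : ∀ w ∈ R, (inner ℝ (R.starProjection (J w)) (R.starProjection (J w)) : ℝ)
      = c ^ 2 * inner ℝ w w := by
    intro w hw
    rw [real_inner_self_eq_norm_sq, real_inner_self_eq_norm_sq, hc w hw]
    ring
  -- Polarization of `hsq`.
  have hpol : ∀ w' ∈ R, (inner ℝ (R.starProjection (J w)) (R.starProjection (J w')) : ℝ)
      = c ^ 2 * inner ℝ w w' := by
    intro w' hw'
    have h := hsq _ (R.add_mem hw hw')
    simp only [map_add, inner_add_left, inner_add_right, hsq w hw, hsq w' hw',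
      real_inner_comm w w'] at h
    rw [real_inner_comm (R.starProjection (J w)) (R.starProjection (J w'))] at h
    linarith
  have hz : ∀ u ∈ R,
      (inner ℝ (R.starProjection (J (R.starProjection (J w))) + c ^ 2 • w) u : ℝ) = 0 := by
    intro u hu
    rw [inner_add_left, inner_starProjection_left_of_mem R hu,
      inner_complexStructure_left hJ hJi, real_inner_comm,
      ← inner_starProjection_left_of_mem R (R.starProjection_apply_mem _), real_inner_comm,
      hpol u hu, real_inner_smul_left]
    ring
  -- The vector lies in `R` and is orthogonal to `R`, hence to itself.
  exact eq_neg_of_add_eq_zero_left ((inner_self_eq_zero (𝕜 := ℝ)).1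
    (hz _ (R.add_mem (R.starProjection_apply_mem _) (R.smul_mem _ hw))))

/-- Split `J w` into its two parts, apply `J` and project to `R`: the total is -w and the tangential
part contributes -c² w. -/
lemma starProjection_normal_of_slant (hJ : ∀ v, J (J v) = -v)
    (hJi : ∀ v w, inner ℝ (J v) (J w) = (inner ℝ v w : ℝ)) {c : ℝ}
    (hc : ∀ w ∈ R, ‖R.starProjection (J w)‖ = c * ‖w‖) {w : V} (hw : w ∈ R) :
    R.starProjection (J (Rᗮ.starProjection (J w))) = -((1 - c ^ 2) • w) := by
  have h1 := starProjection_sq_of_slant R hJ hJi hc hw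
  have h2 := congrArg (fun v ↦ R.starProjection (J v)) (starProjection_add_orthogonal R (J w))
  simp only [map_add, hJ, h1, map_neg, Submodule.starProjection_eq_self_iff.2 hw] at h2
  rw [sub_smul, one_smul, neg_sub, ← sub_eq_of_eq_add' h2.symm]
  abel

/-- If the angle between `J w` and its projection is `θ`, the projection has length
`cos θ * ‖w‖`. -/
lemma norm_starProjection_of_angle_eq
    (hJi : ∀ v w, inner ℝ (J v) (J w) = (inner ℝ v w : ℝ)) {θ : ℝ}
    (hθ : ∀ w ∈ R, w ≠ 0 → InnerProductGeometry.angle (J w) (R.starProjection (J w)) = θ)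
    {w : V} (hw : w ∈ R) : ‖R.starProjection (J w)‖ = Real.cos θ * ‖w‖ := by
  rcases eq_or_ne w 0 with rfl | h0
  · simp
  have hn : ‖J w‖ = ‖w‖ := by
    rw [norm_eq_sqrt_real_inner, norm_eq_sqrt_real_inner, hJi]
  have h : (inner ℝ (J w) (R.starProjection (J w)) : ℝ) = ‖R.starProjection (J w)‖ ^ 2 := by
    rw [← inner_starProjection_left_of_mem R (R.starProjection_apply_mem _),
      real_inner_self_eq_norm_sq]
  have hw0 : ‖w‖ ≠ 0 := norm_ne_zero_iff.2 h0
  rw [← hθ w hw h0, InnerProductGeometry.cos_angle, h, hn]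
  -- For a zero projection the angle is π/2 by convention, matching the value 0 of the quotient by
  -- zero.
  rcases eq_or_ne ‖R.starProjection (J w)‖ 0 with hz | hz
  · simp [hz]
  · field_simp

end SlantAlgebra

/-! ### Smoothness of a field from its inner products, via the inverse Gram matrix. -/

section Gram

variable {E : Type*} [NormedAddCommGroup E] [NormedSpace ℝ E] [FiniteDimensional ℝ E]
  {L : Type*} [TopologicalSpace L] [ChartedSpace E L] [IsManifold 𝓘(ℝ, E) ∞ L]
  [RiemannianBundle (fun x : L ↦ TangentSpace 𝓘(ℝ, E) x)]

/-- Positive definiteness gives injectivity, and equal dimensions do the rest. -/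
lemma exists_equiv_eq_localMetric {x y : L} (hy : y ∈ (chartAt E x).source) :
    ∃ e : E ≃L[ℝ] (E →L[ℝ] ℝ), (e : E →L[ℝ] E →L[ℝ] ℝ) = localMetric x y := by
  have hinj : Function.Injective ((localMetric x y : E →L[ℝ] E →L[ℝ] ℝ) : E →ₗ[ℝ] E →L[ℝ] ℝ) := by
    rw [← LinearMap.ker_eq_bot, LinearMap.ker_eq_bot']
    intro a ha
    have h := congrArg (fun f : E →L[ℝ] ℝ ↦ f a) ha
    have h0 : ofComponents x y a = 0 := (inner_self_eq_zero (𝕜 := ℝ)).1 h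
    have h1 := components_ofComponents hy a
    rw [h0] at h1
    rw [← h1, components_eq_continuousLinearMapAt hy, map_zero]
  have hrank : Module.finrank ℝ E = Module.finrank ℝ (E →L[ℝ] ℝ) :=
    (Subspace.dual_finrank_eq (K := ℝ) (V := E)).symm.trans
      (LinearMap.toContinuousLinearMap (𝕜 := ℝ) (E := E) (F' := ℝ)).finrank_eq
  refine ⟨(LinearMap.linearEquivOfInjective _ hinj hrank).toContinuousLinearEquiv, ?_⟩
  ext a b
  rfl

variable [IsContMDiffRiemannianBundle 𝓘(ℝ, E) ∞ E (fun x : L ↦ TangentSpace 𝓘(ℝ, E) x)]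

/-- A vector field is smooth if its inner products with the coordinate fields are. -/
lemma isSmoothField_of_inner {X : ∀ l : L, TangentSpace 𝓘(ℝ, E) l}
    (h : ∀ (l : L) (a : E), ContMDiffAt 𝓘(ℝ, E) 𝓘(ℝ, ℝ) ∞
      (fun m ↦ (inner ℝ (X m) (ofComponents l m a) : ℝ)) l) : IsSmoothField X := by
  intro l
  refine (contMDiffAt_section l).2 ?_
  have hl := mem_chart_source E l
  have hs := (chartAt E l).open_source.mem_nhds hl
  have hf : ContMDiffAt 𝓘(ℝ, E) 𝓘(ℝ, E →L[ℝ] ℝ) ∞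
      (fun m ↦ localMetric l m (components l m (X m))) l := by
    refine contMDiffAt_clm_of_apply fun a ↦ (h l a).congr_of_eventuallyEq ?_
    filter_upwards [hs] with m hm
    rw [localMetric_apply, ofComponents_components hm]
  obtain ⟨e, he⟩ := exists_equiv_eq_localMetric hl
  -- Inversion is smooth at invertible operators, so the components are a smooth operator applied to
  -- the smooth covector in `hf`.
  have hinv : ContMDiffAt 𝓘(ℝ, E) 𝓘(ℝ, (E →L[ℝ] ℝ) →L[ℝ] E) ∞
      (fun m ↦ (localMetric (F := E) l m).inverse) l := by
    have h1 := (contDiffAt_map_inverse (n := ∞) e).contMDiffAt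
    rw [he] at h1
    exact h1.comp l (contMDiffAt_localMetric hl)
  refine (hinv.clm_apply hf).congr_of_eventuallyEq ?_
  filter_upwards [hs] with m hm
  obtain ⟨e', he'⟩ := exists_equiv_eq_localMetric hm
  rw [← he', ContinuousLinearMap.inverse_equiv]
  exact (e'.symm_apply_apply _).symm

end Gram

/-! ### Projections onto the range of a conformal map and their smoothness. -/

section Conformal

variable {E : Type*} [NormedAddCommGroup E] [NormedSpace ℝ E] [FiniteDimensional ℝ E]
  {L : Type*} [TopologicalSpace L] [ChartedSpace E L] [IsManifold 𝓘(ℝ, E) ∞ L]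
  [RiemannianBundle (fun x : L ↦ TangentSpace 𝓘(ℝ, E) x)]
  {F : Type*} [NormedAddCommGroup F] [NormedSpace ℝ F] [FiniteDimensional ℝ F]
  {K : Type*} [TopologicalSpace K] [ChartedSpace F K] [IsManifold 𝓘(ℝ, F) ∞ K]
  [RiemannianBundle (fun x : K ↦ TangentSpace 𝓘(ℝ, F) x)]
  {G : L → K}

lemma inner_adjointMap_left (l : L) (w : TangentSpace 𝓘(ℝ, F) (G l)) (v : TangentSpace 𝓘(ℝ, E) l) :
    (inner ℝ (adjointMap G l w) v : ℝ) = inner ℝ w (dmap G l v) := by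
  rw [adjointMap, LinearMap.adjoint_inner_left]
  rfl

lemma adjointMap_mem (l : L) (w : TangentSpace 𝓘(ℝ, F) (G l)) :
    adjointMap (E := E) G l w ∈ (kerG (F := F) G l)ᗮ := by
  refine (Submodule.mem_orthogonal' _ _).2 fun k hk ↦ ?_
  have hk' : dmap G l k = 0 := hk
  rw [inner_adjointMap_left, hk', inner_zero_right]

lemma tanPart_mem (l : L) (w : TangentSpace 𝓘(ℝ, F) (G l)) :
    tanPart (E := E) G l w ∈ rangeG (E := E) G l :=
  Submodule.starProjection_apply_mem _ _

lemma norPart_mem (l : L) (w : TangentSpace 𝓘(ℝ, F) (G l)) :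
    norPart (E := E) G l w ∈ (rangeG (E := E) G l)ᗮ :=
  Submodule.starProjection_apply_mem _ _

lemma tanPart_add_norPart (l : L) (w : TangentSpace 𝓘(ℝ, F) (G l)) :
    tanPart (E := E) G l w + norPart (E := E) G l w = w :=
  starProjection_add_orthogonal _ w

lemma tanPart_eq_self {l : L} {w : TangentSpace 𝓘(ℝ, F) (G l)} (hw : w ∈ rangeG (E := E) G l) :
    tanPart (E := E) G l w = w :=
  Submodule.starProjection_eq_self_iff.2 hw

lemma norPart_eq_self {l : L} {w : TangentSpace 𝓘(ℝ, F) (G l)} (hw : w ∈ (rangeG (E := E) G l)ᗮ) :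
    norPart (E := E) G l w = w :=
  Submodule.starProjection_eq_self_iff.2 hw

lemma inner_eq_zero_of_mem_range {l : L} {w p : TangentSpace 𝓘(ℝ, F) (G l)}
    (hw : w ∈ rangeG (E := E) G l) (hp : p ∈ (rangeG (E := E) G l)ᗮ) : (inner ℝ w p : ℝ) = 0 :=
  (Submodule.mem_orthogonal _ _).1 hp w hw

lemma inner_norPart_left {l : L} {p : TangentSpace 𝓘(ℝ, F) (G l)}
    (hp : p ∈ (rangeG (E := E) G l)ᗮ) (w : TangentSpace 𝓘(ℝ, F) (G l)) :
    (inner ℝ (norPart (E := E) G l w) p : ℝ) = inner ℝ w p :=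
  inner_starProjection_left_of_mem _ hp w

lemma dmap_mem (l : L) (v : TangentSpace 𝓘(ℝ, E) l) :
    dmap (F := F) G l v ∈ rangeG (E := E) G l :=
  LinearMap.mem_range_self _ v

lemma exists_horizontal_dmap_eq (l : L) {w : TangentSpace 𝓘(ℝ, F) (G l)}
    (hw : w ∈ rangeG (E := E) G l) :
    ∃ v ∈ (kerG (E := E) (F := F) G l)ᗮ, dmap G l v = w := by
  obtain ⟨v, hv⟩ := hw
  have h := starProjection_add_orthogonal (kerG (E := E) (F := F) G l) v
  have h0 : dmap (F := F) G l ((kerG (E := E) (F := F) G l).starProjection v) = 0 :=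
    Submodule.starProjection_apply_mem (kerG (E := E) (F := F) G l) v
  refine ⟨_, Submodule.starProjection_apply_mem _ v, ?_⟩
  have h1 : dmap (F := F) G l v = w := hv
  rw [← h1, ← zero_add (dmap G l _), ← h0, ← map_add, h]

lemma pushField_mem (X : ∀ l : L, TangentSpace 𝓘(ℝ, E) l) (l : L) :
    pushField (F := F) G X l ∈ rangeG (E := E) G l :=
  dmap_mem l (X l)

lemma mem_rangeG_of_inner_eq_zero {l : L} {w : TangentSpace 𝓘(ℝ, F) (G l)}
    (h : ∀ p ∈ (rangeG (E := E) G l)ᗮ, (inner ℝ w p : ℝ) = 0) : w ∈ rangeG (E := E) G l := by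
  have h0 : norPart (E := E) G l w = 0 := by
    refine (inner_self_eq_zero (𝕜 := ℝ)).1 ?_
    rw [inner_norPart_left (norPart_mem l w), h _ (norPart_mem l w)]
  rw [← tanPart_add_norPart (E := E) l w, h0, add_zero]
  exact tanPart_mem l w

section Dilation

variable {r : ℝ} {l : L}

/-- For a conformal map, the tangential projection is `r⁻² G_* *G_*`. -/
lemma tanPart_eq_smul (hr : 0 < r)
    (hconf : ∀ X Y : TangentSpace 𝓘(ℝ, E) l,
      X ∈ (kerG (F := F) G l)ᗮ → Y ∈ (kerG (F := F) G l)ᗮ →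
        inner ℝ (dmap (F := F) G l X) (dmap (F := F) G l Y) = r ^ 2 * inner ℝ X Y)
    (w : TangentSpace 𝓘(ℝ, F) (G l)) :
    tanPart (E := E) G l w = (r ^ 2)⁻¹ • dmap G l (adjointMap (E := E) G l w) := by
  refine Submodule.eq_starProjection_of_mem_of_inner_eq_zero
    (Submodule.smul_mem _ _ (dmap_mem l _)) fun u hu ↦ ?_
  obtain ⟨v, hv, rfl⟩ := exists_horizontal_dmap_eq l hu
  rw [inner_sub_left, real_inner_smul_left, hconf _ _ (adjointMap_mem l w) hv,
    inner_adjointMap_left, inv_mul_cancel_left₀ (by positivity), sub_self]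

/-- Source of the factor λ² on the left-hand side of the criterion. -/
lemma dmap_adjointMap_eq_smul (hr : 0 < r)
    (hconf : ∀ X Y : TangentSpace 𝓘(ℝ, E) l,
      X ∈ (kerG (F := F) G l)ᗮ → Y ∈ (kerG (F := F) G l)ᗮ →
        inner ℝ (dmap (F := F) G l X) (dmap (F := F) G l Y) = r ^ 2 * inner ℝ X Y)
    {w : TangentSpace 𝓘(ℝ, F) (G l)} (hw : w ∈ rangeG (E := E) G l) :
    dmap G l (adjointMap (E := E) G l w) = r ^ 2 • w := by
  have h := tanPart_eq_smul hr hconf w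
  rw [tanPart_eq_self hw] at h
  have hr' : r ^ 2 ≠ 0 := by positivity
  conv_rhs => rw [h]
  rw [smul_inv_smul₀ hr']

end Dilation

variable [IsContMDiffRiemannianBundle 𝓘(ℝ, E) ∞ E (fun x : L ↦ TangentSpace 𝓘(ℝ, E) x)]
  [IsContMDiffRiemannianBundle 𝓘(ℝ, F) ∞ F (fun x : K ↦ TangentSpace 𝓘(ℝ, F) x)]
  {V : ∀ l : L, TangentSpace 𝓘(ℝ, F) (G l)}

/-- Pairing with coordinate fields moves the adjoint to G_*, which is smooth. -/
lemma IsSmoothAlong.isSmoothField_adjointMap (hV : IsSmoothAlong (E := E) G V) :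
    IsSmoothField (fun l ↦ adjointMap (E := E) G l (V l)) := by
  refine isSmoothField_of_inner fun l a ↦ ?_
  simp only [inner_adjointMap_left]
  refine contMDiffAt_inner_along (hV l) ?_
  exact ((hV.contMDiff_base.contMDiff_tangentMap (m := ∞) (by simp)).contMDiffAt).comp l
    (contMDiffAt_ofComponents (mem_chart_source E l) a)

/-- The formula λ⁻² G_* *G_* yields smoothness without a local frame of the range. -/
lemma IsSmoothAlong.tanPart (hV : IsSmoothAlong (E := E) G V)
    (hG : IsConformalRiemannianMap (E := E) (F := F) G) :
    IsSmoothAlong (E := E) G (fun l ↦ tanPart (E := E) G l (V l)) := by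
  obtain ⟨hGs, lam, hlam, hpos, hconf⟩ := hG
  have hc : ContMDiff 𝓘(ℝ, E) 𝓘(ℝ, ℝ) ∞ (fun l ↦ (lam l ^ 2)⁻¹) := by
    intro l
    have h : ContDiffAt ℝ ∞ (fun t : ℝ ↦ (t ^ 2)⁻¹) (lam l) :=
      (contDiffAt_id.pow 2).inv (pow_ne_zero 2 (hpos l).ne')
    exact h.contMDiffAt.comp l (hlam l)
  have h := (IsSmoothAlong.pushField hV.isSmoothField_adjointMap hGs).smul hc
  have heq : (fun l ↦ ConformalSlant.tanPart (E := E) G l (V l))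
      = fun l ↦ (lam l ^ 2)⁻¹ •
        ConformalSlant.pushField G (fun l ↦ adjointMap (E := E) G l (V l)) l := by
    funext l
    exact tanPart_eq_smul (hpos l) (hconf l) (V l)
  rw [heq]
  exact h

lemma IsSmoothAlong.norPart (hV : IsSmoothAlong (E := E) G V)
    (hG : IsConformalRiemannianMap (E := E) (F := F) G) :
    IsSmoothAlong (E := E) G (fun l ↦ norPart (E := E) G l (V l)) := by
  have h := hV.sub (hV.tanPart hG)
  have heq : (fun l ↦ ConformalSlant.norPart (E := E) G l (V l))
      = fun l ↦ V l - ConformalSlant.tanPart (E := E) G l (V l) := by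
    funext l
    exact eq_sub_of_add_eq' (tanPart_add_norPart l (V l))
  rw [heq]
  exact h

end Conformal

/-! ### Identities for ρ, ϖ, 𝒟, ℰ and the second fundamental form. -/

section Slant

variable {E : Type*} [NormedAddCommGroup E] [NormedSpace ℝ E] [FiniteDimensional ℝ E]
  {L : Type*} [TopologicalSpace L] [ChartedSpace E L] [IsManifold 𝓘(ℝ, E) ∞ L]
  [RiemannianBundle (fun x : L ↦ TangentSpace 𝓘(ℝ, E) x)]
  {F : Type*} [NormedAddCommGroup F] [NormedSpace ℝ F] [FiniteDimensional ℝ F]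
  {K : Type*} [TopologicalSpace K] [ChartedSpace F K] [IsManifold 𝓘(ℝ, F) ∞ K]
  [RiemannianBundle (fun x : K ↦ TangentSpace 𝓘(ℝ, F) x)]
  {G : L → K}
  {φ : ∀ x : K, TangentSpace 𝓘(ℝ, F) x →L[ℝ] TangentSpace 𝓘(ℝ, F) x}
  {W P : ∀ l : L, TangentSpace 𝓘(ℝ, F) (G l)} {Θ : L → ℝ}

lemma IsKaehler.toLinearMap_sq (hφ : IsKaehler φ) (x : K) (v : TangentSpace 𝓘(ℝ, F) x) :
    (φ x).toLinearMap ((φ x).toLinearMap v) = -v :=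
  hφ.sq_eq_neg x v

lemma IsKaehler.inner_toLinearMap (hφ : IsKaehler φ) (x : K) (v w : TangentSpace 𝓘(ℝ, F) x) :
    (inner ℝ ((φ x).toLinearMap v) ((φ x).toLinearMap w) : ℝ) = inner ℝ v w :=
  hφ.hermitian x v w

lemma norm_tanPart_apply (hφ : IsKaehler φ) (hG : IsCPSRM (E := E) φ G Θ) (l : L)
    (w : TangentSpace 𝓘(ℝ, F) (G l)) (hw : w ∈ rangeG (E := E) G l) :
    ‖(rangeG (E := E) G l).starProjection ((φ (G l)).toLinearMap w)‖ = Real.cos (Θ l) * ‖w‖ := by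
  have key := norm_starProjection_of_angle_eq (rangeG (E := E) G l) (J := (φ (G l)).toLinearMap)
    (hφ.inner_toLinearMap (G l)) (θ := Θ l)
  refine key (fun w hw h0 ↦ ?_) hw
  have h := hG.2 l w hw h0
  rw [wirtingerAngle, tanPart] at h
  exact h

/-- `ρ² = -cos² Θ` on the range of a slant map. -/
lemma rho_rho (hφ : IsKaehler φ) (hG : IsCPSRM (E := E) φ G Θ)
    (hW : ∀ l, W l ∈ rangeG (E := E) G l) (l : L) :
    rho (E := E) φ G (rho (E := E) φ G W) l = -(Real.cos (Θ l) ^ 2 • W l) := by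
  have h := starProjection_sq_of_slant (rangeG (E := E) G l) (J := (φ (G l)).toLinearMap)
    (hφ.toLinearMap_sq (G l)) (hφ.inner_toLinearMap (G l)) (norm_tanPart_apply hφ hG l) (hW l)
  simp only [rho, tanPart]
  exact h

/-- `𝒟 ϖ = -sin² Θ` on the range of a slant map. -/
lemma calD_varpi (hφ : IsKaehler φ) (hG : IsCPSRM (E := E) φ G Θ)
    (hW : ∀ l, W l ∈ rangeG (E := E) G l) (l : L) :
    calD (E := E) φ G (varpi (E := E) φ G W) l = -((1 - Real.cos (Θ l) ^ 2) • W l) := by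
  have h := starProjection_normal_of_slant (rangeG (E := E) G l) (J := (φ (G l)).toLinearMap)
    (hφ.toLinearMap_sq (G l)) (hφ.inner_toLinearMap (G l)) (norm_tanPart_apply hφ hG l) (hW l)
  simp only [calD, varpi, tanPart, norPart]
  exact h

lemma IsKaehler.inner_apply_left (hφ : IsKaehler φ) (x : K) (v w : TangentSpace 𝓘(ℝ, F) x) :
    (inner ℝ (φ x v) w : ℝ) = -inner ℝ v (φ x w) :=
  inner_complexStructure_left (J := (φ x).toLinearMap) (hφ.toLinearMap_sq x)
    (hφ.inner_toLinearMap x) v w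

lemma calE_mem (P : ∀ l : L, TangentSpace 𝓘(ℝ, F) (G l)) (l : L) :
    calE (E := E) φ G P l ∈ (rangeG (E := E) G l)ᗮ :=
  norPart_mem l _

variable [T2Space K]
  [IsContMDiffRiemannianBundle 𝓘(ℝ, E) ∞ E (fun x : L ↦ TangentSpace 𝓘(ℝ, E) x)]
  [IsContMDiffRiemannianBundle 𝓘(ℝ, F) ∞ F (fun x : K ↦ TangentSpace 𝓘(ℝ, F) x)]

lemma IsSmoothAlong.rho (hW : IsSmoothAlong (E := E) G W) (hφ : IsKaehler φ)
    (hG : IsCPSRM (E := E) φ G Θ) : IsSmoothAlong (E := E) G (rho (E := E) φ G W) :=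
  (hW.apply_kaehler hφ).tanPart hG.1

lemma IsSmoothAlong.varpi (hW : IsSmoothAlong (E := E) G W) (hφ : IsKaehler φ)
    (hG : IsCPSRM (E := E) φ G Θ) : IsSmoothAlong (E := E) G (varpi (E := E) φ G W) :=
  (hW.apply_kaehler hφ).norPart hG.1

/-- `φ ∇W = ∇ρW + ∇ϖW`. -/
lemma apply_pullbackCov (hφ : IsKaehler φ) (hG : IsCPSRM (E := E) φ G Θ)
    (hW : IsSmoothAlong (E := E) G W) (l : L) (v : TangentSpace 𝓘(ℝ, E) l) :
    φ (G l) (pullbackCov G W l v)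
      = pullbackCov G (rho (E := E) φ G W) l v + pullbackCov G (varpi (E := E) φ G W) l v := by
  rw [← hφ.pullbackCov_apply hW, ← pullbackCov_add (hW.rho hφ hG) (hW.varpi hφ hG)]
  congr 1
  funext m
  exact (tanPart_add_norPart m _).symm

/-- For `W` tangent and `P` normal, `g(∇ϖW, ℰP) - g(∇ϖρW, P) = sin² Θ g(∇W, P) - g(𝒟P, ∇ϖW)`. -/
lemma inner_pullbackCov_varpi_sub (hφ : IsKaehler φ) (hG : IsCPSRM (E := E) φ G Θ)
    (hW : IsSmoothAlong (E := E) G W) (hWr : ∀ l, W l ∈ rangeG (E := E) G l)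
    (hP : IsNormalField (E := E) G P) (l : L) (v : TangentSpace 𝓘(ℝ, E) l) :
    (inner ℝ (pullbackCov G (varpi (E := E) φ G W) l v) (calE (E := E) φ G P l)
        - inner ℝ (pullbackCov G (varpi (E := E) φ G (rho (E := E) φ G W)) l v) (P l) : ℝ)
      = (1 - Real.cos (Θ l) ^ 2) * inner ℝ (pullbackCov G W l v) (P l)
        - inner ℝ (calD (E := E) φ G P l) (pullbackCov G (varpi (E := E) φ G W) l v) := by
  have hρ := hW.rho hφ hG
  have hPs : IsSmoothAlong (E := E) G P := hP.1
  have hJi := hφ.hermitian (G l)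
  have e1 : (inner ℝ (pullbackCov G W l v) (P l) : ℝ)
      = inner ℝ (pullbackCov G (rho (E := E) φ G W) l v) (φ (G l) (P l))
        + inner ℝ (pullbackCov G (varpi (E := E) φ G W) l v) (φ (G l) (P l)) := by
    rw [← hJi, apply_pullbackCov hφ hG hW, inner_add_left]
  have e2 : (inner ℝ (pullbackCov G (varpi (E := E) φ G W) l v) (φ (G l) (P l)) : ℝ)
      = inner ℝ (calD (E := E) φ G P l) (pullbackCov G (varpi (E := E) φ G W) l v)
        + inner ℝ (pullbackCov G (varpi (E := E) φ G W) l v) (calE (E := E) φ G P l) := by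
    conv_lhs => rw [← tanPart_add_norPart (E := E) l (φ (G l) (P l)), inner_add_right,
      real_inner_comm]
    rfl
  have e3 : (inner ℝ (pullbackCov G (rho (E := E) φ G W) l v) (φ (G l) (P l)) : ℝ)
      = -inner ℝ (pullbackCov G (rho (E := E) φ G (rho (E := E) φ G W)) l v) (P l)
        - inner ℝ (pullbackCov G (varpi (E := E) φ G (rho (E := E) φ G W)) l v) (P l) := by
    have h := hφ.inner_apply_left (G l) (pullbackCov G (rho (E := E) φ G W) l v) (P l)
    have h' := congrArg (fun u ↦ (inner ℝ u (P l) : ℝ)) (apply_pullbackCov hφ hG hρ l v)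
    simp only [inner_add_left] at h'
    linarith
  have e4 : (inner ℝ (pullbackCov G (rho (E := E) φ G (rho (E := E) φ G W)) l v) (P l) : ℝ)
      = -(Real.cos (Θ l) ^ 2 * inner ℝ (pullbackCov G W l v) (P l)) := by
    -- The derivative is moved onto `P`, ρ² = -cos²Θ is used pointwise, and the derivative is moved
    -- back; thus Θ, which need not be smooth, is never differentiated.
    rw [inner_pullbackCov_eq_neg (hρ.rho hφ hG) hPs
        (fun m ↦ inner_eq_zero_of_mem_range (tanPart_mem m _) (hP.2 m)),
      inner_pullbackCov_eq_neg hW hPs (fun m ↦ inner_eq_zero_of_mem_range (hWr m) (hP.2 m)),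
      rho_rho hφ hG hWr, inner_neg_left, real_inner_smul_left]
    ring
  linear_combination -e1 - e2 - e3 + e4

lemma isNormalField_varpi (hφ : IsKaehler φ) (hG : IsCPSRM (E := E) φ G Θ)
    (hW : IsSmoothAlong (E := E) G W) : IsNormalField (E := E) G (varpi (E := E) φ G W) :=
  ⟨hW.varpi hφ hG, fun l ↦ norPart_mem l _⟩

lemma isHorizontalField_adjointMap_calD (hφ : IsKaehler φ) (hG : IsCPSRM (E := E) φ G Θ)
    (hP : IsNormalField (E := E) G P) :
    IsHorizontalField (F := F) G (fun m ↦ adjointMap (E := E) G m (calD (E := E) φ G P m)) := by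
  have h : IsSmoothAlong (E := E) G (calD (E := E) φ G P) :=
    (IsSmoothAlong.apply_kaehler (V := P) hP.1 hφ).tanPart hG.1
  exact ⟨h.isSmoothField_adjointMap, fun l ↦ adjointMap_mem l _⟩

lemma pushField_adjointMap_calD {r : ℝ} {l : L} (hr : 0 < r)
    (hconf : ∀ X Y : TangentSpace 𝓘(ℝ, E) l,
      X ∈ (kerG (F := F) G l)ᗮ → Y ∈ (kerG (F := F) G l)ᗮ →
        inner ℝ (dmap (F := F) G l X) (dmap (F := F) G l Y) = r ^ 2 * inner ℝ X Y) :
    pushField (F := F) G (fun m ↦ adjointMap (E := E) G m (calD (E := E) φ G P m)) l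
      = r ^ 2 • calD (E := E) φ G P l :=
  dmap_adjointMap_eq_smul hr hconf (tanPart_mem l _)

/-- The term G_*(∇^L_Y X) is tangent, so the connection of L drops out. -/
lemma secondFundFormPerp_inner {Y X : ∀ l : L, TangentSpace 𝓘(ℝ, E) l} {l : L}
    {p : TangentSpace 𝓘(ℝ, F) (G l)} (hp : p ∈ (rangeG (E := E) G l)ᗮ) :
    (inner ℝ (secondFundFormPerp (F := F) G Y X l) p : ℝ)
      = inner ℝ (pullbackCov G (pushField G X) l (Y l)) p := by
  rw [secondFundFormPerp, inner_norPart_left hp, secondFundForm, inner_sub_left,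
    inner_eq_zero_of_mem_range (dmap_mem l _) hp, sub_zero]

/-- The second fundamental form against a normal field is minus the shape operator. -/
lemma inner_pullbackCov_pushField (hGs : ContMDiff 𝓘(ℝ, E) 𝓘(ℝ, F) ∞ G)
    {Z : ∀ l : L, TangentSpace 𝓘(ℝ, E) l} (hZ : IsSmoothField Z)
    (hP : IsNormalField (E := E) G P) (l : L) (v : TangentSpace 𝓘(ℝ, E) l) :
    (inner ℝ (pullbackCov G (pushField G Z) l v) (P l) : ℝ)
      = -inner ℝ (pushField G Z l) (pullbackCov G P l v) :=
  inner_pullbackCov_eq_neg (IsSmoothAlong.pushField hZ hGs) hP.1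
    (fun m ↦ inner_eq_zero_of_mem_range (dmap_mem m _) (hP.2 m)) l v

lemma inner_pullbackCov_pushField_comm (hGs : ContMDiff 𝓘(ℝ, E) 𝓘(ℝ, F) ∞ G)
    {Y Z : ∀ l : L, TangentSpace 𝓘(ℝ, E) l} (hY : IsSmoothField Y) (hZ : IsSmoothField Z) {l : L}
    {p : TangentSpace 𝓘(ℝ, F) (G l)} (hp : p ∈ (rangeG (E := E) G l)ᗮ) :
    (inner ℝ (pullbackCov G (pushField G Z) l (Y l)) p : ℝ)
      = inner ℝ (pullbackCov G (pushField G Y) l (Z l)) p := by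
  have h := inner_eq_zero_of_mem_range (pullbackCov_pushField_sub_mem hGs hY hZ l) hp
  rw [inner_sub_left] at h
  linarith

/-- Extend `p` to a field on K, restrict it along G and take the normal part. -/
lemma exists_isNormalField_apply_eq (hG : IsConformalRiemannianMap (E := E) (F := F) G) {l : L}
    {p : TangentSpace 𝓘(ℝ, F) (G l)} (hp : p ∈ (rangeG (E := E) G l)ᗮ) :
    ∃ P : ∀ l : L, TangentSpace 𝓘(ℝ, F) (G l), IsNormalField (E := E) G P ∧ P l = p := by
  obtain ⟨A, hA, hAp⟩ := exists_isSmoothField_apply_eq (G l) p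
  have h : IsSmoothAlong (E := E) G (fun m ↦ A (G m)) := ContMDiff.comp hA hG.1
  refine ⟨fun m ↦ norPart (E := E) G m (A (G m)), ⟨h.norPart hG, fun m ↦ norPart_mem m _⟩, ?_⟩
  simp only [hAp]
  exact norPart_eq_self hp

end Slant
end ConformalSlant

end


/-! ### The criterion. -/

open ConformalSlant in
theorem theorem4p3
    {E : Type*} [NormedAddCommGroup E] [NormedSpace ℝ E] [FiniteDimensional ℝ E]
    {L : Type*} [TopologicalSpace L] [T2Space L] [ChartedSpace E L] [IsManifold 𝓘(ℝ, E) ∞ L]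
    [RiemannianBundle (fun x : L ↦ TangentSpace 𝓘(ℝ, E) x)]
    [IsContMDiffRiemannianBundle 𝓘(ℝ, E) ∞ E (fun x : L ↦ TangentSpace 𝓘(ℝ, E) x)]
    {F : Type*} [NormedAddCommGroup F] [NormedSpace ℝ F] [FiniteDimensional ℝ F]
    {K : Type*} [TopologicalSpace K] [T2Space K] [ChartedSpace F K] [IsManifold 𝓘(ℝ, F) ∞ K]
    [RiemannianBundle (fun x : K ↦ TangentSpace 𝓘(ℝ, F) x)]
    [IsContMDiffRiemannianBundle 𝓘(ℝ, F) ∞ F (fun x : K ↦ TangentSpace 𝓘(ℝ, F) x)]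
    (φ : ∀ x : K, TangentSpace 𝓘(ℝ, F) x →L[ℝ] TangentSpace 𝓘(ℝ, F) x) (hφ : IsKaehler φ)
    (G : L → K) (Θ : L → ℝ) (hG : IsCPSRM (E := E) φ G Θ) (hΘ : IsProperSlant Θ) :
    RangeTotallyGeodesic (E := E) (F := F) G ↔
      ∀ (Y Z : ∀ l : L, TangentSpace 𝓘(ℝ, E) l) (P : ∀ l : L, TangentSpace 𝓘(ℝ, F) (G l)),
        IsHorizontalField (F := F) G Y → IsHorizontalField (F := F) G Z →
        IsNormalField (E := E) G P →
        ∀ l : L,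
          inner ℝ
              (secondFundFormPerp (F := F) G Y
                (fun m ↦ adjointMap (E := E) G m (calD (E := E) φ G P m)) l)
              (varpi (E := E) φ G (pushField G Z) l)
            = inner ℝ (normalCov (E := E) G (varpi (E := E) φ G (pushField G Z)) l (Y l))
                (calE (E := E) φ G P l)
              - inner ℝ
                (normalCov (E := E) G
                  (varpi (E := E) φ G (rho (E := E) φ G (pushField G Z))) l (Y l))
                (P l) := by
  obtain ⟨hGs, lam, hlam, hpos, hconf⟩ := hG.1
  have hnor {Z : ∀ l : L, TangentSpace 𝓘(ℝ, E) l} (hZ : IsHorizontalField (E := E) (F := F) G Z) :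
      IsNormalField (E := E) G (varpi (E := E) φ G (pushField G Z)) :=
    isNormalField_varpi hφ hG (IsSmoothAlong.pushField hZ.1 hGs)
  -- the left-hand side
  have hL {Y Z : ∀ l : L, TangentSpace 𝓘(ℝ, E) l}
      {P : ∀ l : L, TangentSpace 𝓘(ℝ, F) (G l)} (hZ : IsHorizontalField (F := F) G Z)
      (hP : IsNormalField (E := E) G P) (l : L) :
      (inner ℝ (secondFundFormPerp (F := F) G Y
          (fun m ↦ adjointMap (E := E) G m (calD (E := E) φ G P m)) l)
          (varpi (E := E) φ G (pushField G Z) l) : ℝ)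
        = -(lam l ^ 2 * inner ℝ (calD (E := E) φ G P l)
            (pullbackCov G (varpi (E := E) φ G (pushField G Z)) l (Y l))) := by
    rw [secondFundFormPerp_inner ((hnor hZ).2 l),
      inner_pullbackCov_pushField hGs (isHorizontalField_adjointMap_calD hφ hG hP).1 (hnor hZ),
      pushField_adjointMap_calD (hpos l) (hconf l), real_inner_smul_left]
  -- the right-hand side
  have hR {Y Z : ∀ l : L, TangentSpace 𝓘(ℝ, E) l}
      {P : ∀ l : L, TangentSpace 𝓘(ℝ, F) (G l)} (hZ : IsHorizontalField (F := F) G Z)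
      (hP : IsNormalField (E := E) G P) (l : L) :
      (inner ℝ (normalCov (E := E) G (varpi (E := E) φ G (pushField G Z)) l (Y l))
            (calE (E := E) φ G P l)
          - inner ℝ (normalCov (E := E) G
            (varpi (E := E) φ G (rho (E := E) φ G (pushField G Z))) l (Y l)) (P l) : ℝ)
        = (1 - Real.cos (Θ l) ^ 2) * inner ℝ (pullbackCov G (pushField G Z) l (Y l)) (P l)
          - inner ℝ (calD (E := E) φ G P l)
            (pullbackCov G (varpi (E := E) φ G (pushField G Z)) l (Y l)) := by
    rw [normalCov, normalCov, inner_norPart_left (calE_mem P l), inner_norPart_left (hP.2 l)]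
    exact inner_pullbackCov_varpi_sub hφ hG (IsSmoothAlong.pushField hZ.1 hGs)
      (pushField_mem Z) hP l (Y l)
  -- the shape operator of `ϖ G_* Z` on `𝒟 P`
  have hD {Y Z : ∀ l : L, TangentSpace 𝓘(ℝ, E) l}
      {P : ∀ l : L, TangentSpace 𝓘(ℝ, F) (G l)} (hZ : IsHorizontalField (F := F) G Z)
      (hP : IsNormalField (E := E) G P) (l : L) :
      (lam l ^ 2 * inner ℝ (calD (E := E) φ G P l)
            (pullbackCov G (varpi (E := E) φ G (pushField G Z)) l (Y l)) : ℝ)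
        = -inner ℝ (pullbackCov G (pushField G
            (fun m ↦ adjointMap (E := E) G m (calD (E := E) φ G P m))) l (Y l))
            (varpi (E := E) φ G (pushField G Z) l) := by
    rw [← secondFundFormPerp_inner ((hnor hZ).2 l), hL hZ hP l, neg_neg]
  have hlam2 (l : L) : lam l ^ 2 ≠ 0 := pow_ne_zero 2 (hpos l).ne'
  -- Properness enters here, as sin²Θ ≠ 0.
  have hs (l : L) : 1 - Real.cos (Θ l) ^ 2 ≠ 0 := by
    rw [← Real.sin_sq]
    exact pow_ne_zero 2
      (Real.sin_pos_of_pos_of_lt_pi (hΘ l).1 (by linarith [(hΘ l).2, Real.pi_pos])).ne'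
  constructor
  · intro h Y Z P hY hZ hP l
    have h1 := hD (Y := Y) hZ hP l
    rw [inner_eq_zero_of_mem_range
      (h Y _ hY (isHorizontalField_adjointMap_calD hφ hG hP) l) ((hnor hZ).2 l), neg_zero] at h1
    rw [hL hZ hP, hR hZ hP, inner_eq_zero_of_mem_range (h Y Z hY hZ l) (hP.2 l),
      (mul_eq_zero.1 h1).resolve_left (hlam2 l)]
    simp
  · intro h Y₀ Z₀ hY₀ hZ₀ l
    have hrel {Y Z : ∀ l : L, TangentSpace 𝓘(ℝ, E) l}
        {P : ∀ l : L, TangentSpace 𝓘(ℝ, F) (G l)} (hY : IsHorizontalField (F := F) G Y)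
        (hZ : IsHorizontalField (F := F) G Z)
        (hP : IsNormalField (E := E) G P) :
        ((1 - Real.cos (Θ l) ^ 2) * inner ℝ (pullbackCov G (pushField G Z) l (Y l)) (P l) : ℝ)
          = -((lam l ^ 2 - 1) * inner ℝ (calD (E := E) φ G P l)
              (pullbackCov G (varpi (E := E) φ G (pushField G Z)) l (Y l))) := by
      have := h Y Z P hY hZ hP l
      rw [hL hZ hP, hR hZ hP] at this
      linarith
    -- Take P = ϖG_*U: since 𝒟ϖ = -sin²Θ, the factor sin²Θ cancels from both sides of `hrel`.
    have hskew {Y Z U : ∀ l : L, TangentSpace 𝓘(ℝ, E) l}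
        (hY : IsHorizontalField (F := F) G Y) (hZ : IsHorizontalField (F := F) G Z)
        (hU : IsHorizontalField (F := F) G U) :
        (inner ℝ (pullbackCov G (pushField G Z) l (Y l))
            (varpi (E := E) φ G (pushField G U) l) : ℝ)
          = -((lam l ^ 2 - 1) * inner ℝ (pullbackCov G (pushField G U) l (Y l))
            (varpi (E := E) φ G (pushField G Z) l)) := by
      have h1 := hrel hY hZ (hnor hU)
      rw [calD_varpi hφ hG (pushField_mem U), inner_neg_left, real_inner_smul_left] at h1
      rw [inner_pullbackCov_pushField hGs hU.1 (hnor hZ)]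
      refine mul_left_cancel₀ (hs l) ?_
      rw [h1]
      ring
    have hsymm {Y Z U : ∀ l : L, TangentSpace 𝓘(ℝ, E) l}
        (hY : IsHorizontalField (F := F) G Y) (hZ : IsHorizontalField (F := F) G Z)
        (hU : IsHorizontalField (F := F) G U) :=
      inner_pullbackCov_pushField_comm hGs hY.1 hZ.1 ((hnor hU).2 l)
    have hzero {Y Z U : ∀ l : L, TangentSpace 𝓘(ℝ, E) l}
        (hY : IsHorizontalField (F := F) G Y) (hZ : IsHorizontalField (F := F) G Z)
        (hU : IsHorizontalField (F := F) G U) :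
        (inner ℝ (pullbackCov G (pushField G Z) l (Y l))
            (varpi (E := E) φ G (pushField G U) l) : ℝ) = 0 := by
      have h1 := hskew hY hZ hU
      -- T(Y,Z,U) = -t T(U,Y,Z) = t² T(Z,U,Y) = -t³ T(Y,Z,U), with t = λ² - 1.
      rw [hsymm hY hU hZ, hskew hU hY hZ, hsymm hU hZ hY, hskew hZ hU hY, hsymm hZ hY hU] at h1
      -- This is 1 + t³ = (1 + t)(t² - t + 1), where t² - t + 1 = (t - 1/2)² + 3/4.
      have hc : 0 < lam l ^ 2 * ((lam l ^ 2 - 1) ^ 2 - (lam l ^ 2 - 1) + 1) :=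
        mul_pos (pow_pos (hpos l) 2) (by nlinarith [sq_nonneg (lam l ^ 2 - 1 - 1 / 2)])
      refine (mul_eq_zero.1 ?_).resolve_left hc.ne'
      linear_combination h1
    refine mem_rangeG_of_inner_eq_zero fun p hp ↦ ?_
    obtain ⟨P, hP, rfl⟩ := exists_isNormalField_apply_eq hG.1 hp
    have h1 := hD (Y := Y₀) hZ₀ hP l
    -- For a general normal `P`, the vanishing of T is applied with *G_*𝒟P in the second slot, which
    -- kills the right-hand side of `hrel`.
    rw [hzero hY₀ (isHorizontalField_adjointMap_calD hφ hG hP) hZ₀, neg_zero] at h1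
    have h2 := hrel hY₀ hZ₀ hP
    rw [(mul_eq_zero.1 h1).resolve_left (hlam2 l), mul_zero, neg_zero] at h2
    exact (mul_eq_zero.1 h2).resolve_left (hs l)
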